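/- Let $\mathbb{S}$ be the following (strict) 2-category. A 0-cell, written $X/G$, is a finite group $G$ together with a finite $G$-set $X$. A 1-cell $(\alpha,\theta)\colon X/G\to Y/H$ is a map $\alpha\colon X\to Y$ together with a family of maps $(\theta_x\colon G\to H)_{x\in X}$ such that $\alpha(gx)=\theta_x(g)\alpha(x)$ and $\theta_x(gg')=\theta_{g'x}(g)\theta_x(g')$ for all $x\in X$, $g,g'\in G$; composition is $(\beta,\tau)\circ(\alpha,\theta)=(\beta\circ\alpha,(\tau_{\alpha(x)}\circ\theta_x)_x)$. A 2-cell $\varepsilon\colon(\alpha,\theta)\Rightarrow(\alpha',\theta')$ is a family $(\varepsilon_x\in H)_{x\in X}$ with $\alpha'(x)=\varepsilon_x\alpha(x)$ and $\varepsilon_{gx}\theta_x(g)\varepsilon_x^{-1}=\theta'_x(g)$; vertical composition is pointwise multiplication. Write $\emptyset$ for a 0-cell whose underlying set is empty. A *semi-Mackey functor* on $\mathbb{S}$ is a pair $M=(M^*,M_*)$ of a contravariant and a covariant 2-functor $\mathbb{S}\to\mathrm{Set}$ (where $\mathrm{Set}$ has only identity 2-cells) such that (0) $M^*(X/G)=M_*(X/G)=:M(X/G)$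 on 0-cells; (1) for every 2-coproduct $X/G\to X/G\sqcup Y/H\leftarrow Y/H$ the natural map $M(X/G\sqcup Y/H)\to M(X/G)\times M(Y/H)$ given by $M^*$ is bijective, and $M(\emptyset)$ is a singleton; (2) $M^*(\alpha)\circ M_*(\beta)=M_*(\gamma)\circ M^*(\delta)$ for every 2-fibered product with projections $\gamma,\delta$ of 1-cells $\alpha,\beta$ with a common target ($\gamma$ going to the source of $\alpha$ and $\delta$ to the source of $\beta$). A morphism is a family of maps $M(X/G)\to N(X/G)$ natural for both parts; the category is $\mathrm{SMack}(\mathbb{S})$. Each $M(X/G)$ is a commutative monoid with addition $M(X/G)\times M(X/G)\cong M((X\sqcup X)/G)\to M(X/G)$, the last map being $M_*$ of the folding map, and with zero the image of $M_*\colon M(\emptyset)\to M(X/G)$. $M$ is a *Mackey functor* if all these monoids are groups, and $\mathrm{Mack}(\mathbb{S})\subseteq\mathrm{SMack}(\mathbb{S})$ is the full subcategory of Mackey functors. For a commutative ring $R$, the category $\mathrm{Mack}^R(\mathbb{S})$ of *$R$-linear Mackey functors* is defined by the same conditions (0), (1), (2), with $R\text{-}\mathrm{Mod}$ in place of $\mathrm{Set}$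 (in (1): the natural map is an isomorphism, and $M(\emptyset)=0$). A *span* to $Y/H$ from $X/G$ is a diagram $S=(Y/H\xleftarrow{\alpha_S}W_S/L_S\xrightarrow{\beta_S}X/G)$ in $\mathbb{S}$. Spans to $Y/H$ from $X/G$ form a 2-category: a 1-cell $S\to T$ is $(\varphi,\mu_Y,\mu_X)$ with $\varphi\colon W_S/L_S\to W_T/L_T$ and 2-cells $\mu_Y\colon\alpha_T\circ\varphi\Rightarrow\alpha_S$, $\mu_X\colon\beta_T\circ\varphi\Rightarrow\beta_S$, and a 2-cell is a 2-cell $\varphi\Rightarrow\varphi'$ of $\mathbb{S}$ compatible with these. Let $[S]$ denote the class of $S$ up to adjoint equivalence in this 2-category. The *span category* $\mathrm{Sp}=\mathrm{Sp}(\mathbb{S})$ has the 0-cells of $\mathbb{S}$ as objects, and its morphisms from $X/G$ to $Y/H$ are the classes $[S]$ of spans to $Y/H$ from $X/G$; composition is by 2-fibered products, and identities are the identity spans. The set $\mathrm{Sp}(X/G,Y/H)$ is a commutative monoid under the sum of spans given by 2-coproducts, with zero $[Y/H\leftarrow\emptyset\to X/G]$, and composition is biadditive. The category $\mathcal{T}$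 has the same objects, with $\mathcal{T}(X/G,Y/H)=K_0(\mathrm{Sp}(X/G,Y/H))$ the group completion and composition extended biadditively; $c\colon\mathrm{Sp}\to\mathcal{T}$ is the canonical functor. For a category $\mathcal{D}$ with finite products, $\mathrm{Add}(-,\mathcal{D})$ denotes the category of functors to $\mathcal{D}$ preserving finite products, with natural transformations as morphisms. Then there are equivalences of categories $$\mathrm{SMack}(\mathbb{S})\xrightarrow{\ \simeq\ }\mathrm{Add}(\mathrm{Sp},\mathrm{Set}),\qquad \mathrm{Mack}(\mathbb{S})\xrightarrow{\ \simeq\ }\mathrm{Add}(\mathcal{T},\mathrm{Set})$$ which commute with the inclusion $\mathrm{Mack}(\mathbb{S})\hookrightarrow\mathrm{SMack}(\mathbb{S})$ and the functor $-\circ c\colon\mathrm{Add}(\mathcal{T},\mathrm{Set})\to\mathrm{Add}(\mathrm{Sp},\mathrm{Set})$. The first sends $M$ to a functor $F$ with $F(X/G)=M(X/G)$ and $F([S])=M_*(\alpha_S)\circ M^*(\beta_S)$ for every span $S$, up to isomorphisms $F(X/G)\cong M(X/G)$ that are natural in $M$. Moreover, for every commutative ring $R$, the same correspondence gives an equivalence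 of categories $$\mathrm{Mack}^R(\mathbb{S})\xrightarrow{\ \simeq\ }\mathrm{Add}(\mathcal{T},R\text{-}\mathrm{Mod}),\qquad M\mapsto F,\quad F(X/G)=M(X/G),\quad F(c[S])=M_*(\alpha_S)\circ M^*(\beta_S),$$ again up to isomorphisms natural in $M$. -/

import Mathlib

universe u w r c d v v2

namespace BisetMackey

open CategoryTheory Bicategory

/-- A finite group `G` together with a finite `G`-set `X`. -/
structure GrSet : Type (u + 1) where
  /-- the acting group -/
  G : Type u
  /-- the underlying set -/
  X : Type u
  [group : Group G]
  [action : MulAction G X]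
  [finiteG : Finite G]
  [finiteX : Finite X]

namespace GrSet

attribute [instance] GrSet.group GrSet.action GrSet.finiteG GrSet.finiteX

/-- A 1-cell `X/G ⟶ Y/H`: a map `X → Y` and a family of maps `act x : G → H` (the acting part). -/
@[ext]
structure Hom (A B : GrSet.{u}) : Type u where
  toFun : A.X → B.X
  act : A.X → A.G → B.G
  map_smul : ∀ (x : A.X) (g : A.G), toFun (g • x) = act x g • toFun x
  act_mul : ∀ (x : A.X) (g g' : A.G), act x (g * g') = act (g' • x) g * act x g'

/-- A 2-cell between 1-cells `f, f' : X/G ⟶ Y/H`. -/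
@[ext]
structure Cell {A B : GrSet.{u}} (f f' : Hom A B) : Type u where
  app : A.X → B.G
  app_smul : ∀ x, f'.toFun x = app x • f.toFun x
  conj : ∀ (x : A.X) (g : A.G), app (g • x) * f.act x g * (app x)⁻¹ = f'.act x g

variable {A B C D : GrSet.{u}}

namespace Hom

@[simp] theorem act_one (f : Hom A B) (x : A.X) : f.act x 1 = 1 := by
  have h := f.act_mul x 1 1
  rw [one_smul, mul_one] at h
  exact left_eq_mul.mp h

theorem act_smul_inv (f : Hom A B) (x : A.X) (g : A.G) : f.act (g⁻¹ • x) g = (f.act x g⁻¹)⁻¹ := by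
  have h := f.act_mul x g g⁻¹
  rw [mul_inv_cancel, f.act_one] at h
  exact eq_inv_of_mul_eq_one_left h.symm

theorem act_inv (f : Hom A B) (x : A.X) (g : A.G) : f.act (g • x) g⁻¹ = (f.act x g)⁻¹ := by
  have h := f.act_mul x g⁻¹ g
  rw [inv_mul_cancel, f.act_one] at h
  exact eq_inv_of_mul_eq_one_left h.symm

/-- The identity 1-cell. -/
@[simps] def id (A : GrSet.{u}) : Hom A A := ⟨fun x => x, fun _ g => g, fun _ _ => rfl, fun _ _ _ => rfl⟩

/-- Composition of 1-cells (in diagrammatic order). -/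
@[simps] def comp (f : Hom A B) (g : Hom B C) : Hom A C :=
  ⟨fun x => g.toFun (f.toFun x), fun x a => g.act (f.toFun x) (f.act x a),
    fun x a => by rw [f.map_smul, g.map_smul],
    fun x a a' => by rw [f.act_mul, g.act_mul, f.map_smul]⟩

end Hom

namespace Cell

variable {f f' f'' : Hom A B}

theorem nat (e : Cell f f') (x : A.X) (g : A.G) :
    e.app (g • x) * f.act x g = f'.act x g * e.app x :=
  mul_inv_eq_iff_eq_mul.mp (e.conj x g)

/-- Build a 2-cell from the multiplicative form of the conjugation condition. -/
@[simps] def mk' (app : A.X → B.G) (h : ∀ x, f'.toFun x = app x • f.toFun x)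
    (h' : ∀ (x : A.X) (g : A.G), app (g • x) * f.act x g = f'.act x g * app x) : Cell f f' :=
  ⟨app, h, fun x g => by rw [h', mul_inv_cancel_right]⟩

/-- The identity 2-cell. -/
@[simps!] def id (f : Hom A B) : Cell f f :=
  mk' (fun _ => 1) (fun _ => (one_smul _ _).symm) (fun _ _ => by rw [one_mul, mul_one])

/-- Vertical composition `e' · e`. -/
@[simps!] def comp (e : Cell f f') (e' : Cell f' f'') : Cell f f'' :=
  mk' (fun x => e'.app x * e.app x) (fun x => by rw [mul_smul, ← e.app_smul, ← e'.app_smul])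
    (fun x g => by rw [mul_assoc, e.nat, ← mul_assoc, e'.nat, mul_assoc])

/-- The inverse of a 2-cell for vertical composition. -/
@[simps!] def inv (e : Cell f f') : Cell f' f :=
  mk' (fun x => (e.app x)⁻¹) (fun x => by rw [e.app_smul, inv_smul_smul])
    (fun x g => by rw [inv_mul_eq_iff_eq_mul, ← mul_assoc, e.nat, mul_inv_cancel_right])

/-- A 2-cell preceded by a 1-cell. -/
@[simps!] def whiskerLeft (f : Hom A B) {g g' : Hom B C} (e : Cell g g') :
    Cell (f.comp g) (f.comp g') :=
  mk' (fun x => e.app (f.toFun x)) (fun _ => e.app_smul _)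
    (fun x a => by rw [f.map_smul]; exact e.nat _ _)

/-- A 2-cell followed by a 1-cell. -/
@[simps!] def whiskerRight {f f' : Hom A B} (e : Cell f f') (h : Hom B C) :
    Cell (f.comp h) (f'.comp h) :=
  mk' (fun x => h.act (f.toFun x) (e.app x))
    (fun x => by rw [Hom.comp_toFun, Hom.comp_toFun, e.app_smul, h.map_smul])
    (fun x g => by
      rw [Hom.comp_act, Hom.comp_act, f.map_smul, ← h.act_mul, e.nat, e.app_smul, ← h.act_mul])

/-- Vertical composition makes the 1-cells between two 0-cells the objects of a category. -/
@[reducible] def category (A B : GrSet.{u}) : Category.{u} (Hom A B) where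
  Hom f f' := Cell f f'
  id f := Cell.id f
  comp e e' := Cell.comp e e'
  id_comp _ := Cell.ext (funext fun _ => mul_one _)
  comp_id _ := Cell.ext (funext fun _ => one_mul _)
  assoc _ _ _ := Cell.ext (funext fun _ => (mul_assoc _ _ _).symm)

end Cell

/-- The 2-category of finite sets with variable finite group actions. -/
instance : Bicategory.{u, u} GrSet.{u} where
  Hom A B := Hom A B
  id A := Hom.id A
  comp f g := Hom.comp f g
  homCategory A B := Cell.category A B
  whiskerLeft {_ _ _} f {_ _} e := Cell.whiskerLeft f e
  whiskerRight e h := Cell.whiskerRight e h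
  associator f g h := @Iso.refl _ (Cell.category _ _) (Hom.comp f (Hom.comp g h))
  leftUnitor f := @Iso.refl _ (Cell.category _ _) f
  rightUnitor f := @Iso.refl _ (Cell.category _ _) f
  whiskerLeft_id _ _ := rfl
  whiskerLeft_comp _ _ _ _ _ _ := rfl
  id_whiskerLeft e := Cell.ext (funext fun _ => by
    change _ = 1 * _ * 1
    rw [one_mul, mul_one]; rfl)
  comp_whiskerLeft f g _ _ e := Cell.ext (funext fun _ => by
    change _ = 1 * _ * 1
    rw [one_mul, mul_one]; rfl)
  id_whiskerRight f h := Cell.ext (funext fun _ => Hom.act_one h _)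
  comp_whiskerRight e e' h := Cell.ext (funext fun x => by
    change Hom.act h _ (Cell.app e' x * Cell.app e x) =
      Hom.act h _ (Cell.app e' x) * Hom.act h _ (Cell.app e x)
    rw [h.act_mul, ← Cell.app_smul e])
  whiskerRight_id e := Cell.ext (funext fun _ => by
    change _ = 1 * _ * 1
    rw [one_mul, mul_one]; rfl)
  whiskerRight_comp e _ _ := Cell.ext (funext fun _ => by
    change _ = 1 * _ * 1
    rw [one_mul, mul_one]; rfl)
  whisker_assoc _ _ _ e _ := Cell.ext (funext fun _ => by
    change _ = 1 * _ * 1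
    rw [one_mul, mul_one]; rfl)
  whisker_exchange {_ _ _ f g h i} e t := Cell.ext (funext fun x => by
    change Hom.act i _ (Cell.app e x) * Cell.app t (f.toFun x) =
      Cell.app t (g.toFun x) * Hom.act h _ (Cell.app e x)
    rw [Cell.app_smul e, Cell.nat t])
  pentagon _ _ _ i := Cell.ext (funext fun _ => by
    change 1 * 1 * Hom.act i _ 1 = 1 * 1
    rw [Hom.act_one, mul_one])
  triangle _ g := Cell.ext (funext fun _ => by
    change 1 * 1 = Hom.act g _ 1
    rw [Hom.act_one, mul_one])

/-- The 2-category is strict: associators and unitors are identities. -/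
instance : Bicategory.Strict GrSet.{u} where
  id_comp _ := rfl
  comp_id _ := rfl
  assoc _ _ _ := rfl
  leftUnitor_eqToIso _ := rfl
  rightUnitor_eqToIso _ := rfl
  associator_eqToIso _ _ _ := rfl

@[ext] theorem cell_ext {f f' : A ⟶ B} {e e' : f ⟶ f'} (h : ∀ x, Cell.app e x = Cell.app e' x) :
    e = e' :=
  Cell.ext (funext h)

@[simp] theorem id_toFun (x : A.X) : Hom.toFun (𝟙 A) x = x := rfl
@[simp] theorem id_act (x : A.X) (g : A.G) : Hom.act (𝟙 A) x g = g := rfl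
@[simp] theorem comp_toFun (f : A ⟶ B) (g : B ⟶ C) (x : A.X) :
    Hom.toFun (f ≫ g) x = g.toFun (f.toFun x) := rfl
@[simp] theorem comp_act (f : A ⟶ B) (g : B ⟶ C) (x : A.X) (a : A.G) :
    Hom.act (f ≫ g) x a = g.act (f.toFun x) (f.act x a) := rfl
@[simp] theorem cell_id_app (f : A ⟶ B) (x : A.X) : Cell.app (𝟙 f) x = 1 := rfl
@[simp] theorem cell_comp_app {f f' f'' : A ⟶ B} (e : f ⟶ f') (e' : f' ⟶ f'') (x : A.X) :
    Cell.app (e ≫ e') x = e'.app x * e.app x := rfl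
@[simp] theorem whiskerLeft_app (f : A ⟶ B) {g g' : B ⟶ C} (e : g ⟶ g') (x : A.X) :
    Cell.app (f ◁ e) x = e.app (f.toFun x) := rfl
@[simp] theorem whiskerRight_app {f f' : A ⟶ B} (e : f ⟶ f') (h : B ⟶ C) (x : A.X) :
    Cell.app (e ▷ h) x = h.act (f.toFun x) (e.app x) := rfl
@[simp] theorem associator_hom_app (f : A ⟶ B) (g : B ⟶ C) (h : C ⟶ D) (x : A.X) :
    Cell.app (α_ f g h).hom x = 1 := rfl
@[simp] theorem associator_inv_app (f : A ⟶ B) (g : B ⟶ C) (h : C ⟶ D) (x : A.X) :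
    Cell.app (α_ f g h).inv x = 1 := rfl
@[simp] theorem leftUnitor_hom_app (f : A ⟶ B) (x : A.X) : Cell.app (λ_ f).hom x = 1 := rfl
@[simp] theorem leftUnitor_inv_app (f : A ⟶ B) (x : A.X) : Cell.app (λ_ f).inv x = 1 := rfl
@[simp] theorem rightUnitor_hom_app (f : A ⟶ B) (x : A.X) : Cell.app (ρ_ f).hom x = 1 := rfl
@[simp] theorem rightUnitor_inv_app (f : A ⟶ B) (x : A.X) : Cell.app (ρ_ f).inv x = 1 := rfl

/-- Every 2-cell is invertible. -/
@[simps] def cellIso {f f' : A ⟶ B} (e : f ⟶ f') : f ≅ f' where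
  hom := e
  inv := Cell.inv e
  hom_inv_id := cell_ext fun x => inv_mul_cancel (e.app x)
  inv_hom_id := cell_ext fun x => mul_inv_cancel (e.app x)


/-! ### 2-coproducts and 2-fibered products -/

/-- `i₁ : A₁ ⟶ P ⟵ A₂ : i₂` is a 2-coproduct. -/
structure IsTwoCoproduct {A₁ A₂ P : GrSet.{u}} (i₁ : A₁ ⟶ P) (i₂ : A₂ ⟶ P) : Prop where
  exists_desc : ∀ {X : GrSet.{u}} (f₁ : A₁ ⟶ X) (f₂ : A₂ ⟶ X),
    ∃ f : P ⟶ X, Nonempty (i₁ ≫ f ⟶ f₁) ∧ Nonempty (i₂ ≫ f ⟶ f₂)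
  existsUnique_cell : ∀ {X : GrSet.{u}} {f₁ : A₁ ⟶ X} {f₂ : A₂ ⟶ X} {f f' : P ⟶ X}
    (ξ₁ : i₁ ≫ f ⟶ f₁) (ξ₂ : i₂ ≫ f ⟶ f₂) (ξ₁' : i₁ ≫ f' ⟶ f₁) (ξ₂' : i₂ ≫ f' ⟶ f₂),
    ∃! η : f ⟶ f', i₁ ◁ η ≫ ξ₁' = ξ₁ ∧ i₂ ◁ η ≫ ξ₂' = ξ₂

/-- `(P, π₁, π₂, κ)` is a 2-fibered product of `f₁ : A₁ ⟶ B` and `f₂ : A₂ ⟶ B`. -/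
structure IsTwoPullback {A₁ A₂ B P : GrSet.{u}} (π₁ : P ⟶ A₁) (π₂ : P ⟶ A₂) (f₁ : A₁ ⟶ B)
    (f₂ : A₂ ⟶ B) (κ : π₁ ≫ f₁ ⟶ π₂ ≫ f₂) : Prop where
  exists_lift : ∀ {X : GrSet.{u}} (g₁ : X ⟶ A₁) (g₂ : X ⟶ A₂) (ϵ : g₁ ≫ f₁ ⟶ g₂ ≫ f₂),
    ∃ (g : X ⟶ P) (ξ₁ : g ≫ π₁ ⟶ g₁) (ξ₂ : g ≫ π₂ ⟶ g₂),
      ξ₁ ▷ f₁ ≫ ϵ = (α_ g π₁ f₁).hom ≫ g ◁ κ ≫ (α_ g π₂ f₂).inv ≫ ξ₂ ▷ f₂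
  existsUnique_cell : ∀ {X : GrSet.{u}} {g₁ : X ⟶ A₁} {g₂ : X ⟶ A₂} (ϵ : g₁ ≫ f₁ ⟶ g₂ ≫ f₂)
    {g g' : X ⟶ P} (ξ₁ : g ≫ π₁ ⟶ g₁) (ξ₂ : g ≫ π₂ ⟶ g₂) (ξ₁' : g' ≫ π₁ ⟶ g₁)
    (ξ₂' : g' ≫ π₂ ⟶ g₂),
    ξ₁ ▷ f₁ ≫ ϵ = (α_ g π₁ f₁).hom ≫ g ◁ κ ≫ (α_ g π₂ f₂).inv ≫ ξ₂ ▷ f₂ →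
    ξ₁' ▷ f₁ ≫ ϵ = (α_ g' π₁ f₁).hom ≫ g' ◁ κ ≫ (α_ g' π₂ f₂).inv ≫ ξ₂' ▷ f₂ →
    ∃! ζ : g ⟶ g', ζ ▷ π₁ ≫ ξ₁' = ξ₁ ∧ ζ ▷ π₂ ≫ ξ₂' = ξ₂

/-! ### The initial 0-cell -/

/-- The empty 0-cell `∅/e`. -/
def empty : GrSet.{u} where
  G := PUnit
  X := PEmpty
  action := { smul := fun _ x => x, one_smul := fun _ => rfl, mul_smul := fun _ _ _ => rfl }

instance : IsEmpty empty.{u}.X := inferInstanceAs (IsEmpty PEmpty)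

/-- The unique 1-cell from the empty 0-cell. -/
def fromEmpty (A : GrSet.{u}) : empty ⟶ A :=
  Hom.mk isEmptyElim isEmptyElim isEmptyElim isEmptyElim

/-! ### Binary 2-coproducts -/

/-- The underlying set of the coproduct of `X/G` and `Y/H`, the `G × H`-set
`Ind X ⊔ Ind Y = (X × H) ⊔ (G × Y)`. -/
def CoprodX (A B : GrSet.{u}) : Type u := (A.X × B.G) ⊕ (A.G × B.X)

instance (A B : GrSet.{u}) : Finite (CoprodX A B) :=
  inferInstanceAs (Finite ((A.X × B.G) ⊕ (A.G × B.X)))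

instance (A B : GrSet.{u}) : MulAction (A.G × B.G) (CoprodX A B) where
  smul a := Sum.map (fun p => (a.1 • p.1, a.2 * p.2)) (fun p => (a.1 * p.1, a.2 • p.2))
  one_smul p := by
    rcases p with ⟨x, k⟩ | ⟨k, y⟩
    · exact congrArg Sum.inl (Prod.ext (one_smul _ _) (one_mul _))
    · exact congrArg Sum.inr (Prod.ext (one_mul _) (one_smul _ _))
  mul_smul a b p := by
    rcases p with ⟨x, k⟩ | ⟨k, y⟩
    · exact congrArg Sum.inl (Prod.ext (mul_smul _ _ _) (mul_assoc _ _ _))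
    · exact congrArg Sum.inr (Prod.ext (mul_assoc _ _ _) (mul_smul _ _ _))

/-- The coproduct of two 0-cells. -/
def coprod (A B : GrSet.{u}) : GrSet.{u} where
  G := A.G × B.G
  X := CoprodX A B

namespace coprod

variable {A B C : GrSet.{u}}

/-- A point of the first summand. -/
def mkl (x : A.X) (k : B.G) : (coprod A B).X := Sum.inl (x, k)
/-- A point of the second summand. -/
def mkr (k : A.G) (y : B.X) : (coprod A B).X := Sum.inr (k, y)
/-- An element of the acting group. -/
def mkG (g : A.G) (h : B.G) : (coprod A B).G := (g, h)

theorem smul_mkl (g : A.G) (h : B.G) (x : A.X) (k : B.G) :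
    mkG g h • mkl x k = mkl (g • x) (h * k) := rfl
theorem smul_mkr (g : A.G) (h : B.G) (k : A.G) (y : B.X) :
    mkG g h • mkr k y = mkr (g * k) (h • y) := rfl
theorem mkG_mul (g g' : A.G) (h h' : B.G) : mkG g h * mkG g' h' = mkG (g * g') (h * h') := rfl

theorem mkl_inj {x x' : A.X} {k k' : B.G} : mkl x k = mkl x' k' ↔ x = x' ∧ k = k' :=
  Sum.inl_injective.eq_iff.trans Prod.ext_iff
theorem mkr_inj {y y' : B.X} {k k' : A.G} : mkr k y = mkr k' y' ↔ k = k' ∧ y = y' :=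
  Sum.inr_injective.eq_iff.trans Prod.ext_iff
theorem mkl_ne_mkr (x : A.X) (k : B.G) (k' : A.G) (y : B.X) : mkl x k ≠ mkr k' y := Sum.inl_ne_inr

theorem ind {P : (coprod A B).X → Prop} (hl : ∀ x k, P (mkl x k)) (hr : ∀ k y, P (mkr k y)) (p) :
    P p := by
  rcases p with ⟨x, k⟩ | ⟨k, y⟩
  exacts [hl x k, hr k y]

variable (A B) in
/-- The first coprojection. -/
def inl : A ⟶ coprod A B :=
  Hom.mk (fun x => mkl x 1) (fun _ g => mkG g 1)
    (fun x g => by rw [smul_mkl, mul_one]) (fun x g g' => by rw [mkG_mul, mul_one])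

variable (A B) in
/-- The second coprojection. -/
def inr : B ⟶ coprod A B :=
  Hom.mk (fun y => mkr 1 y) (fun _ g => mkG 1 g)
    (fun x g => by rw [smul_mkr, mul_one]) (fun x g g' => by rw [mkG_mul, mul_one])

@[simp] theorem inl_toFun (x : A.X) : (inl A B).toFun x = mkl x 1 := rfl
@[simp] theorem inr_toFun (x : B.X) : (inr A B).toFun x = mkr 1 x := rfl
@[simp] theorem inl_act (x : A.X) (g : A.G) : (inl A B).act x g = mkG g 1 := rfl
@[simp] theorem inr_act (x : B.X) (g : B.G) : (inr A B).act x g = mkG 1 g := rfl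

/-- The 1-cell `f ∪ f'` out of a coproduct. -/
def desc (f : A ⟶ C) (f' : B ⟶ C) : coprod A B ⟶ C :=
  Hom.mk (Sum.elim (fun p => f.toFun p.1) (fun p => f'.toFun p.2))
    (Sum.elim (fun p a => f.act p.1 a.1) (fun p a => f'.act p.2 a.2))
    (by
      rintro (⟨x, k⟩ | ⟨k, y⟩) ⟨g, h⟩
      exacts [Hom.map_smul f x g, Hom.map_smul f' y h])
    (by
      rintro (⟨x, k⟩ | ⟨k, y⟩) ⟨g, h⟩ ⟨g', h'⟩
      exacts [Hom.act_mul f x g g', Hom.act_mul f' y h h'])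

@[simp] theorem desc_mkl (f : A ⟶ C) (f' : B ⟶ C) (x : A.X) (k : B.G) :
    (desc f f').toFun (mkl x k) = f.toFun x := rfl
@[simp] theorem desc_mkr (f : A ⟶ C) (f' : B ⟶ C) (k : A.G) (y : B.X) :
    (desc f f').toFun (mkr k y) = f'.toFun y := rfl
@[simp] theorem desc_act_mkl (f : A ⟶ C) (f' : B ⟶ C) (x : A.X) (k : B.G) (g : A.G) (h : B.G) :
    (desc f f').act (mkl x k) (mkG g h) = f.act x g := rfl
@[simp] theorem desc_act_mkr (f : A ⟶ C) (f' : B ⟶ C) (k : A.G) (y : B.X) (g : A.G) (h : B.G) :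
    (desc f f').act (mkr k y) (mkG g h) = f'.act y h := rfl

@[simp] theorem inl_desc (f : A ⟶ C) (f' : B ⟶ C) : inl A B ≫ desc f f' = f := rfl
@[simp] theorem inr_desc (f : A ⟶ C) (f' : B ⟶ C) : inr A B ≫ desc f f' = f' := rfl

/-- A 2-cell between 1-cells out of a coproduct is given by its restrictions. -/
theorem existsUnique_cell {f f' : coprod A B ⟶ C} (η₁ : inl A B ≫ f ⟶ inl A B ≫ f')
    (η₂ : inr A B ≫ f ⟶ inr A B ≫ f') :
    ∃! η : f ⟶ f', inl A B ◁ η = η₁ ∧ inr A B ◁ η = η₂ := by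
  have el : ∀ (x : A.X) (k : B.G), (mkl x k : (coprod A B).X) = mkG 1 k • mkl x 1 := fun x k => by
    rw [smul_mkl, one_smul, mul_one]
  have er : ∀ (k : A.G) (y : B.X), (mkr k y : (coprod A B).X) = mkG k 1 • mkr 1 y := fun k y => by
    rw [smul_mkr, one_smul, mul_one]
  refine ⟨Cell.mk' (Sum.elim
      (fun p => f'.act (mkl p.1 1) (mkG 1 p.2) * η₁.app p.1 * (f.act (mkl p.1 1) (mkG 1 p.2))⁻¹)
      (fun p => f'.act (mkr 1 p.2) (mkG p.1 1) * η₂.app p.2 * (f.act (mkr 1 p.2) (mkG p.1 1))⁻¹))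
    ?_ ?_, ⟨?_, ?_⟩, ?_⟩
  · refine ind (fun x k => ?_) (fun k y => ?_)
    · have h := Cell.app_smul η₁ x
      simp only [comp_toFun, inl_toFun] at h
      change _ = (f'.act (mkl x 1) (mkG 1 k) * η₁.app x * (f.act (mkl x 1) (mkG 1 k))⁻¹) • _
      rw [el x k, f.map_smul, f'.map_smul, h, mul_smul, mul_smul, inv_smul_smul]
    · have h := Cell.app_smul η₂ y
      simp only [comp_toFun, inr_toFun] at h
      change _ = (f'.act (mkr 1 y) (mkG k 1) * η₂.app y * (f.act (mkr 1 y) (mkG k 1))⁻¹) • _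
      rw [er k y, f.map_smul, f'.map_smul, h, mul_smul, mul_smul, inv_smul_smul]
  · refine ind (fun x k => ?_) (fun k y => ?_)
    · rintro ⟨g, h⟩
      have key : ∀ f : coprod A B ⟶ C, f.act (mkl x k) (mkG g h) * f.act (mkl x 1) (mkG 1 k) =
          f.act (mkl (g • x) 1) (mkG 1 (h * k)) * f.act (mkl x 1) (mkG g 1) := fun f => by
        have h1 := f.act_mul (mkl x 1) (mkG g h) (mkG 1 k)
        have h2 := f.act_mul (mkl x 1) (mkG 1 (h * k)) (mkG g 1)
        rw [← el] at h1
        rw [smul_mkl, mul_one] at h2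
        rw [← h1, ← h2, mkG_mul, mkG_mul, one_mul, mul_one, mul_one]
      have hn := Cell.nat η₁ x g
      simp only [comp_act, inl_toFun, inl_act] at hn
      change (f'.act (mkl (g • x) 1) (mkG 1 (h * k)) * η₁.app (g • x) *
        (f.act (mkl (g • x) 1) (mkG 1 (h * k)))⁻¹) * f.act (mkl x k) (mkG g h) =
        f'.act (mkl x k) (mkG g h) * (f'.act (mkl x 1) (mkG 1 k) * η₁.app x *
          (f.act (mkl x 1) (mkG 1 k))⁻¹)
      rw [← mul_assoc, ← mul_assoc, key f', mul_assoc (f'.act _ _) (f'.act _ _), ← hn,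
        eq_mul_inv_iff_mul_eq, mul_assoc _ _ (f.act (mkl x 1) (mkG 1 k)), key f]
      group
    · rintro ⟨g, h⟩
      have key : ∀ f : coprod A B ⟶ C, f.act (mkr k y) (mkG g h) * f.act (mkr 1 y) (mkG k 1) =
          f.act (mkr 1 (h • y)) (mkG (g * k) 1) * f.act (mkr 1 y) (mkG 1 h) := fun f => by
        have h1 := f.act_mul (mkr 1 y) (mkG g h) (mkG k 1)
        have h2 := f.act_mul (mkr 1 y) (mkG (g * k) 1) (mkG 1 h)
        rw [← er] at h1
        rw [smul_mkr, mul_one] at h2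
        rw [← h1, ← h2, mkG_mul, mkG_mul, one_mul, mul_one, mul_one]
      have hn := Cell.nat η₂ y h
      simp only [comp_act, inr_toFun, inr_act] at hn
      change (f'.act (mkr 1 (h • y)) (mkG (g * k) 1) * η₂.app (h • y) *
        (f.act (mkr 1 (h • y)) (mkG (g * k) 1))⁻¹) * f.act (mkr k y) (mkG g h) =
        f'.act (mkr k y) (mkG g h) * (f'.act (mkr 1 y) (mkG k 1) * η₂.app y *
          (f.act (mkr 1 y) (mkG k 1))⁻¹)
      rw [← mul_assoc, ← mul_assoc, key f', mul_assoc (f'.act _ _) (f'.act _ _), ← hn,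
        eq_mul_inv_iff_mul_eq, mul_assoc _ _ (f.act (mkr 1 y) (mkG k 1)), key f]
      group
  · ext x
    change f'.act (mkl x 1) 1 * η₁.app x * (f.act (mkl x 1) 1)⁻¹ = _
    rw [Hom.act_one, Hom.act_one, inv_one, one_mul, mul_one]
  · ext y
    change f'.act (mkr 1 y) 1 * η₂.app y * (f.act (mkr 1 y) 1)⁻¹ = _
    rw [Hom.act_one, Hom.act_one, inv_one, one_mul, mul_one]
  · rintro η ⟨rfl, rfl⟩
    refine cell_ext (ind (fun x k => ?_) (fun k y => ?_))
    · have h := Cell.nat η (mkl x 1) (mkG 1 k)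
      rw [← el] at h
      exact eq_mul_inv_iff_mul_eq.mpr h
    · have h := Cell.nat η (mkr 1 y) (mkG k 1)
      rw [← er] at h
      exact eq_mul_inv_iff_mul_eq.mpr h

variable (A B) in
theorem isTwoCoproduct : IsTwoCoproduct (inl A B) (inr A B) where
  exists_desc f₁ f₂ := ⟨desc f₁ f₂, ⟨𝟙 f₁⟩, ⟨𝟙 f₂⟩⟩
  existsUnique_cell ξ₁ ξ₂ ξ₁' ξ₂' := by
    refine (existsUnique_congr fun η => and_congr ?_ ?_).mp
      (existsUnique_cell (ξ₁ ≫ (cellIso ξ₁').inv) (ξ₂ ≫ (cellIso ξ₂').inv))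
    · exact (cellIso ξ₁').eq_comp_inv
    · exact (cellIso ξ₂').eq_comp_inv

end coprod

/-- The 0-cell `(X ⊔ X)/G`. -/
def double (A : GrSet.{u}) : GrSet.{u} where
  G := A.G
  X := A.X ⊕ A.X

/-- The first inclusion `X/G ⟶ (X ⊔ X)/G`. -/
def double.inl (A : GrSet.{u}) : A ⟶ double A :=
  Hom.mk Sum.inl (fun _ g => g) (fun _ _ => rfl) (fun _ _ _ => rfl)

/-- The second inclusion `X/G ⟶ (X ⊔ X)/G`. -/
def double.inr (A : GrSet.{u}) : A ⟶ double A :=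
  Hom.mk Sum.inr (fun _ g => g) (fun _ _ => rfl) (fun _ _ _ => rfl)

/-- The folding map `(X ⊔ X)/G ⟶ X/G`. -/
def double.fold (A : GrSet.{u}) : double A ⟶ A :=
  Hom.mk (Sum.elim id id) (fun _ g => g) (by rintro (x | x) g <;> rfl) (fun _ _ _ => rfl)

theorem double.isTwoCoproduct (A : GrSet.{u}) :
    IsTwoCoproduct (double.inl A) (double.inr A) where
  exists_desc f₁ f₂ := ⟨Hom.mk (Sum.elim f₁.toFun f₂.toFun) (Sum.elim f₁.act f₂.act)
    (by rintro (x | x) g; exacts [f₁.map_smul x g, f₂.map_smul x g])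
    (by rintro (x | x) g g'; exacts [f₁.act_mul x g g', f₂.act_mul x g g']), ⟨𝟙 f₁⟩, ⟨𝟙 f₂⟩⟩
  existsUnique_cell {X f₁ f₂ f f'} ξ₁ ξ₂ ξ₁' ξ₂' := by
    let η₁ : double.inl A ≫ f ⟶ double.inl A ≫ f' := ξ₁ ≫ (cellIso ξ₁').inv
    let η₂ : double.inr A ≫ f ⟶ double.inr A ≫ f' := ξ₂ ≫ (cellIso ξ₂').inv
    refine ⟨Cell.mk (Sum.elim η₁.app η₂.app)
      (by rintro (x | x); exacts [η₁.app_smul x, η₂.app_smul x])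
      (by rintro (x | x) g; exacts [η₁.conj x g, η₂.conj x g]),
      ⟨(cellIso ξ₁').eq_comp_inv.mp rfl, (cellIso ξ₂').eq_comp_inv.mp rfl⟩, ?_⟩
    rintro η ⟨h₁, h₂⟩
    replace h₁ : double.inl A ◁ η = η₁ := (cellIso ξ₁').eq_comp_inv.mpr h₁
    replace h₂ : double.inr A ◁ η = η₂ := (cellIso ξ₂').eq_comp_inv.mpr h₂
    refine cell_ext ?_
    rintro (x | x)
    exacts [congrArg (fun e => Cell.app e x) h₁, congrArg (fun e => Cell.app e x) h₂]

/-! ### 2-fibered products -/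

/-- The set `{(x, y, k) ∈ X × Y × K | β(y) = k α(x)}`. -/
@[ext]
structure CommaX {A B C : GrSet.{u}} (α : A ⟶ C) (β : B ⟶ C) : Type u where
  fst : A.X
  snd : B.X
  arr : C.G
  eq : β.toFun snd = arr • α.toFun fst

section comma

variable {A B C : GrSet.{u}} (α : A ⟶ C) (β : B ⟶ C)

instance : Finite (CommaX α β) :=
  Finite.of_injective (fun p => (p.fst, p.snd, p.arr))
    (fun _ _ h => CommaX.ext (congrArg (fun t => t.1) h) (congrArg (fun t => t.2.1) h)
      (congrArg (fun t => t.2.2) h))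

instance : MulAction (A.G × B.G) (CommaX α β) where
  smul a p := ⟨a.1 • p.fst, a.2 • p.snd, β.act p.snd a.2 * p.arr * (α.act p.fst a.1)⁻¹, by
    rw [α.map_smul, β.map_smul, mul_smul, mul_smul, inv_smul_smul, p.eq]⟩
  one_smul p := CommaX.ext (one_smul _ _) (one_smul _ _) (by
    change β.act p.snd 1 * p.arr * (α.act p.fst 1)⁻¹ = p.arr
    rw [Hom.act_one, Hom.act_one, inv_one, one_mul, mul_one])
  mul_smul a b p := CommaX.ext (mul_smul _ _ _) (mul_smul _ _ _) (by
    change β.act p.snd (a.2 * b.2) * p.arr * (α.act p.fst (a.1 * b.1))⁻¹ =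
      β.act (b.2 • p.snd) a.2 * (β.act p.snd b.2 * p.arr * (α.act p.fst b.1)⁻¹) *
        (α.act (b.1 • p.fst) a.1)⁻¹
    rw [Hom.act_mul, Hom.act_mul, mul_inv_rev]
    simp only [mul_assoc])

/-- The 2-fibered product of two 1-cells. -/
def comma : GrSet.{u} where
  G := A.G × B.G
  X := CommaX α β

/-- The first projection. -/
def comma.fst : comma α β ⟶ A :=
  Hom.mk (fun p => CommaX.fst p) (fun _ a => Prod.fst a) (fun _ _ => rfl) (fun _ _ _ => rfl)

/-- The second projection. -/
def comma.snd : comma α β ⟶ B :=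
  Hom.mk (fun p => CommaX.snd p) (fun _ a => Prod.snd a) (fun _ _ => rfl) (fun _ _ _ => rfl)

/-- The canonical 2-cell. -/
def comma.cell : comma.fst α β ≫ α ⟶ comma.snd α β ≫ β :=
  Cell.mk' (fun p => CommaX.arr p) (fun p => CommaX.eq p) (fun p a => by
    change β.act (CommaX.snd p) (Prod.snd a) * CommaX.arr p *
      (α.act (CommaX.fst p) (Prod.fst a))⁻¹ * α.act (CommaX.fst p) (Prod.fst a) =
      β.act (CommaX.snd p) (Prod.snd a) * CommaX.arr p
    rw [inv_mul_cancel_right])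

theorem comma.isTwoPullback :
    IsTwoPullback (comma.fst α β) (comma.snd α β) α β (comma.cell α β) where
  exists_lift {X} g₁ g₂ ϵ := by
    refine ⟨Hom.mk (fun x => (⟨g₁.toFun x, g₂.toFun x, ϵ.app x, ϵ.app_smul x⟩ : CommaX α β))
      (fun x g => (g₁.act x g, g₂.act x g))
      (fun x g => CommaX.ext (g₁.map_smul x g) (g₂.map_smul x g) ?_)
      (fun x g g' => Prod.ext (g₁.act_mul x g g') (g₂.act_mul x g g')), 𝟙 g₁, 𝟙 g₂, ?_⟩
    · exact eq_mul_inv_iff_mul_eq.mpr (ϵ.nat x g)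
    · ext x
      change ϵ.app x * α.act _ 1 = β.act _ 1 * 1 * ϵ.app x * 1
      rw [Hom.act_one, Hom.act_one, mul_one, mul_one, mul_one, one_mul]
  existsUnique_cell {X g₁ g₂} ϵ {g g'} ξ₁ ξ₂ ξ₁' ξ₂' h h' := by
    let ζ₁ : g ≫ comma.fst α β ⟶ g' ≫ comma.fst α β := ξ₁ ≫ (cellIso ξ₁').inv
    let ζ₂ : g ≫ comma.snd α β ⟶ g' ≫ comma.snd α β := ξ₂ ≫ (cellIso ξ₂').inv
    have e₁ : ζ₁ ≫ ξ₁' = ξ₁ := (cellIso ξ₁').eq_comp_inv.mp rfl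
    have e₂ : ζ₂ ≫ ξ₂' = ξ₂ := (cellIso ξ₂').eq_comp_inv.mp rfl
    have hx : ∀ x, β.act (CommaX.snd (g.toFun x)) (ζ₂.app x) * CommaX.arr (g.toFun x) =
        CommaX.arr (g'.toFun x) * α.act (CommaX.fst (g.toFun x)) (ζ₁.app x) := fun x => by
      have k := congrArg (fun e => Cell.app e x) h
      have k' := congrArg (fun e => Cell.app e x) h'
      change ϵ.app x * α.act (CommaX.fst (g.toFun x)) (ξ₁.app x) =
        β.act (CommaX.snd (g.toFun x)) (ξ₂.app x) * 1 * CommaX.arr (g.toFun x) * 1 at k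
      change ϵ.app x * α.act (CommaX.fst (g'.toFun x)) (ξ₁'.app x) =
        β.act (CommaX.snd (g'.toFun x)) (ξ₂'.app x) * 1 * CommaX.arr (g'.toFun x) * 1 at k'
      have a₁ : α.act (CommaX.fst (g.toFun x)) (ξ₁.app x) =
          α.act (CommaX.fst (g'.toFun x)) (ξ₁'.app x) *
            α.act (CommaX.fst (g.toFun x)) (ζ₁.app x) := by
        rw [← e₁, cell_comp_app, α.act_mul]
        exact congrArg (fun t => α.act t _ * _) (ζ₁.app_smul x).symm
      have a₂ : β.act (CommaX.snd (g.toFun x)) (ξ₂.app x) =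
          β.act (CommaX.snd (g'.toFun x)) (ξ₂'.app x) *
            β.act (CommaX.snd (g.toFun x)) (ζ₂.app x) := by
        rw [← e₂, cell_comp_app, β.act_mul]
        exact congrArg (fun t => β.act t _ * _) (ζ₂.app_smul x).symm
      rw [mul_one, mul_one] at k k'
      rw [a₁, a₂, ← mul_assoc, k', mul_assoc, mul_assoc] at k
      exact (mul_left_cancel k).symm
    refine ⟨Cell.mk' (fun x => (ζ₁.app x, ζ₂.app x))
      (fun x => CommaX.ext (ζ₁.app_smul x) (ζ₂.app_smul x) ?_)
      (fun x a => Prod.ext (ζ₁.nat x a) (ζ₂.nat x a)), ⟨e₁, e₂⟩, ?_⟩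
    · exact eq_mul_inv_iff_mul_eq.mpr (hx x).symm
    · rintro ζ ⟨h₁, h₂⟩
      replace h₁ : ζ ▷ comma.fst α β = ζ₁ := (cellIso ξ₁').eq_comp_inv.mpr h₁
      replace h₂ : ζ ▷ comma.snd α β = ζ₂ := (cellIso ξ₂').eq_comp_inv.mpr h₂
      refine cell_ext fun x => Prod.ext ?_ ?_
      exacts [congrArg (fun e => Cell.app e x) h₁, congrArg (fun e => Cell.app e x) h₂]

end comma


/-! ### Equivalences of 0-cells, elementwise -/

/-- A 1-cell that is fully faithful on the associated action groupoids. -/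
structure IsFF {A B : GrSet.{u}} (f : A ⟶ B) : Prop where
  full : ∀ (x x' : A.X) (h : B.G), h • f.toFun x = f.toFun x' → ∃ g, g • x = x' ∧ f.act x g = h
  faithful : ∀ (x : A.X) (g g' : A.G), g • x = g' • x → f.act x g = f.act x g' → g = g'

/-- A 1-cell that is an equivalence on the associated action groupoids. -/
structure IsEqv {A B : GrSet.{u}} (f : A ⟶ B) : Prop extends IsFF f where
  surj : ∀ y : B.X, ∃ (x : A.X) (h : B.G), h • f.toFun x = y

section Eqv

variable {A B C : GrSet.{u}}

theorem IsFF.id (A : GrSet.{u}) : IsFF (𝟙 A) :=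
  ⟨fun _ _ h e => ⟨h, e, rfl⟩, fun _ _ _ _ e => e⟩

theorem IsEqv.id (A : GrSet.{u}) : IsEqv (𝟙 A) :=
  ⟨IsFF.id A, fun y => ⟨y, 1, one_smul _ _⟩⟩

theorem IsFF.comp {f : A ⟶ B} {g : B ⟶ C} (hf : IsFF f) (hg : IsFF g) : IsFF (f ≫ g) where
  full x x' h e := by
    obtain ⟨b, hb, rfl⟩ := hg.full _ _ h e
    obtain ⟨a, ha, rfl⟩ := hf.full _ _ b hb
    exact ⟨a, ha, rfl⟩
  faithful x a a' e e' := by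
    refine hf.faithful x a a' e (hg.faithful _ _ _ ?_ e')
    rw [← f.map_smul, ← f.map_smul, e]

theorem IsEqv.comp {f : A ⟶ B} {g : B ⟶ C} (hf : IsEqv f) (hg : IsEqv g) : IsEqv (f ≫ g) where
  toIsFF := hf.toIsFF.comp hg.toIsFF
  surj z := by
    obtain ⟨y, h, rfl⟩ := hg.surj z
    obtain ⟨x, k, rfl⟩ := hf.surj y
    exact ⟨x, h * g.act _ k, by rw [mul_smul, g.map_smul]; rfl⟩

theorem isEqv_of_cells {f : A ⟶ B} {g : B ⟶ A} (unit : 𝟙 A ⟶ f ≫ g) (counit : g ≫ f ⟶ 𝟙 B) :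
    IsEqv f := by
  have faith : ∀ {A B : GrSet.{u}} {f : A ⟶ B} {g : B ⟶ A} (_ : 𝟙 A ⟶ f ≫ g) (x : A.X)
      (a a' : A.G), a • x = a' • x → f.act x a = f.act x a' → a = a' := by
    intro A B f g η x a a' e e'
    have h := η.nat x a
    have h' := η.nat x a'
    simp only [id_act, comp_act] at h h'
    rw [e, e', ← h'] at h
    exact mul_left_cancel h
  refine ⟨⟨fun x x' h e => ?_, faith unit⟩, fun y => ⟨g.toFun y, counit.app y,
    (counit.app_smul y).symm⟩⟩
  have hx := unit.app_smul x
  have hx' := unit.app_smul x'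
  simp only [id_toFun, comp_toFun] at hx hx'
  have hk := g.map_smul (f.toFun x) h
  rw [e] at hk
  have ha : ((unit.app x')⁻¹ * (g.act (f.toFun x) h * unit.app x)) • x = x' := by
    rw [mul_smul, mul_smul, ← hx, ← hk, hx', inv_smul_smul]
  refine ⟨_, ha, ?_⟩
  have hn := unit.nat x ((unit.app x')⁻¹ * (g.act (f.toFun x) h * unit.app x))
  simp only [id_act, comp_act] at hn
  rw [ha, mul_inv_cancel_left] at hn
  refine (faith (cellIso counit).inv _ _ _ ?_ (mul_right_cancel hn)).symm
  rw [e, ← f.map_smul, ha]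

end Eqv

/-! ### Spans -/

/-- A span to `X` from `Y`. -/
structure Span (X Y : GrSet.{u}) : Type (u + 1) where
  /-- the middle 0-cell -/
  W : GrSet.{u}
  /-- the leg to `X` -/
  l : W ⟶ X
  /-- the leg to `Y` -/
  r : W ⟶ Y

namespace Span

variable {X Y Z V : GrSet.{u}}

/-- A 1-cell `(φ, μ_X, μ_Y)` between spans. -/
@[ext]
structure Hom (S T : Span X Y) : Type u where
  φ : S.W ⟶ T.W
  μl : φ ≫ T.l ⟶ S.l
  μr : φ ≫ T.r ⟶ S.r

/-- A 2-cell between 1-cells of spans. -/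
@[ext]
structure Cell {S T : Span X Y} (f f' : Hom S T) : Type u where
  cell : f.φ ⟶ f'.φ
  wl : cell ▷ T.l ≫ f'.μl = f.μl
  wr : cell ▷ T.r ≫ f'.μr = f.μr

/-- The identity 1-cell of a span. -/
@[simps] def Hom.id (S : Span X Y) : Hom S S := ⟨𝟙 S.W, (λ_ S.l).hom, (λ_ S.r).hom⟩

/-- The composition `(ψ ∘ φ, μ_X · (ν_X ∘ φ), μ_Y · (ν_Y ∘ φ))`. -/
@[simps] def Hom.comp {S T P : Span X Y} (f : Hom S T) (g : Hom T P) : Hom S P where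
  φ := f.φ ≫ g.φ
  μl := (α_ f.φ g.φ P.l).hom ≫ f.φ ◁ g.μl ≫ f.μl
  μr := (α_ f.φ g.φ P.r).hom ≫ f.φ ◁ g.μr ≫ f.μr

/-- Vertical composition of 2-cells of spans is that of the underlying 2-cells. -/
@[reducible] def Cell.category (S T : Span X Y) : Category.{u} (Hom S T) where
  Hom f f' := Cell f f'
  id f := ⟨𝟙 f.φ, by simp, by simp⟩
  comp e e' := ⟨e.cell ≫ e'.cell, by rw [comp_whiskerRight, Category.assoc, e'.wl, e.wl],
    by rw [comp_whiskerRight, Category.assoc, e'.wr, e.wr]⟩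
  id_comp _ := Cell.ext (Category.id_comp _)
  comp_id _ := Cell.ext (Category.comp_id _)
  assoc _ _ _ := Cell.ext (Category.assoc _ _ _)

@[simp] theorem Hom.comp_μl_app {S T P : Span X Y} (f : Hom S T) (g : Hom T P) (x : S.W.X) :
    GrSet.Cell.app (Hom.comp f g).μl x = f.μl.app x * g.μl.app (f.φ.toFun x) := mul_one _
@[simp] theorem Hom.comp_μr_app {S T P : Span X Y} (f : Hom S T) (g : Hom T P) (x : S.W.X) :
    GrSet.Cell.app (Hom.comp f g).μr x = f.μr.app x * g.μr.app (f.φ.toFun x) := mul_one _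

theorem Cell.wl_app {S T : Span X Y} {f f' : Hom S T} (e : Cell f f') (x : S.W.X) :
    f'.μl.app x * T.l.act (f.φ.toFun x) (e.cell.app x) = f.μl.app x :=
  congrArg (fun c => GrSet.Cell.app c x) e.wl
theorem Cell.wr_app {S T : Span X Y} {f f' : Hom S T} (e : Cell f f') (x : S.W.X) :
    f'.μr.app x * T.r.act (f.φ.toFun x) (e.cell.app x) = f.μr.app x :=
  congrArg (fun c => GrSet.Cell.app c x) e.wr

/-- Build a 2-cell between 1-cells of spans from pointwise conditions. -/
def Cell.mk' {S T : Span X Y} {f f' : Hom S T} (c : f.φ ⟶ f'.φ)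
    (wl : ∀ x, f'.μl.app x * T.l.act (f.φ.toFun x) (c.app x) = f.μl.app x)
    (wr : ∀ x, f'.μr.app x * T.r.act (f.φ.toFun x) (c.app x) = f.μr.app x) : Cell f f' :=
  ⟨c, cell_ext wl, cell_ext wr⟩

/-- 2-cells between 1-cells of spans are invertible. -/
@[simps hom] def Cell.iso {S T : Span X Y} {f f' : Hom S T} (c : f.φ ≅ f'.φ)
    (wl : ∀ x, f'.μl.app x * T.l.act (f.φ.toFun x) (c.hom.app x) = f.μl.app x)
    (wr : ∀ x, f'.μr.app x * T.r.act (f.φ.toFun x) (c.hom.app x) = f.μr.app x) :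
    @Iso _ (Cell.category S T) f f' :=
  @Iso.mk _ (Cell.category S T) f f' (Cell.mk' c.hom wl wr)
    (Cell.mk c.inv
      (by
        have h : c.hom ▷ T.l ≫ f'.μl = f.μl := cell_ext wl
        rw [← h, inv_hom_whiskerRight_assoc])
      (by
        have h : c.hom ▷ T.r ≫ f'.μr = f.μr := cell_ext wr
        rw [← h, inv_hom_whiskerRight_assoc]))
    (Cell.ext c.hom_inv_id) (Cell.ext c.inv_hom_id)

/-- The 2-category of spans to `X` from `Y`. -/
instance : Bicategory.{u, u} (Span X Y) where
  Hom S T := Hom S T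
  id S := Hom.id S
  comp f g := Hom.comp f g
  homCategory S T := Cell.category S T
  whiskerLeft {_ _ P} f {g g'} e := Cell.mk' (f := Hom.comp f g) (f' := Hom.comp f g')
    (f.φ ◁ e.cell)
    (fun x => by
      rw [Hom.comp_μl_app, Hom.comp_μl_app, ← Cell.wl_app e, ← mul_assoc]; rfl)
    (fun x => by
      rw [Hom.comp_μr_app, Hom.comp_μr_app, ← Cell.wr_app e, ← mul_assoc]; rfl)
  whiskerRight {_ _ P f f'} e h := Cell.mk' (f := Hom.comp f h) (f' := Hom.comp f' h)
    (e.cell ▷ h.φ)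
    (fun x => by
      rw [Hom.comp_μl_app, Hom.comp_μl_app, ← Cell.wl_app e, mul_assoc, mul_assoc, ← h.μl.nat,
        ← e.cell.app_smul]; rfl)
    (fun x => by
      rw [Hom.comp_μr_app, Hom.comp_μr_app, ← Cell.wr_app e, mul_assoc, mul_assoc, ← h.μr.nat,
        ← e.cell.app_smul]; rfl)
  associator {S _ _ T} f g h :=
    Cell.iso (f := Hom.comp (Hom.comp f g) h) (f' := (Hom.comp f (Hom.comp g h))) (α_ f.φ g.φ h.φ)
        (fun x => by
          simp only [Hom.comp_μl_app, associator_hom_app, Hom.act_one, mul_one, mul_assoc]; rfl)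
        (fun x => by
          simp only [Hom.comp_μr_app, associator_hom_app, Hom.act_one, mul_one, mul_assoc]; rfl)
  leftUnitor {S T} f :=
    Cell.iso (f := Hom.comp (Hom.id S) f) (f' := f) (λ_ f.φ)
        (fun x => by
          simp only [Hom.comp_μl_app, leftUnitor_hom_app, Hom.act_one, mul_one, Hom.id_μl, one_mul]
          rfl)
        (fun x => by
          simp only [Hom.comp_μr_app, leftUnitor_hom_app, Hom.act_one, mul_one, Hom.id_μr, one_mul]
          rfl)
  rightUnitor {S T} f :=
    Cell.iso (f := Hom.comp f (Hom.id T)) (f' := f) (ρ_ f.φ)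
        (fun x => by
          simp only [Hom.comp_μl_app, rightUnitor_hom_app, leftUnitor_hom_app, Hom.act_one, mul_one,
            Hom.id_μl])
        (fun x => by
          simp only [Hom.comp_μr_app, rightUnitor_hom_app, leftUnitor_hom_app, Hom.act_one, mul_one,
            Hom.id_μr])
  whiskerLeft_id _ _ := Cell.ext (whiskerLeft_id _ _)
  whiskerLeft_comp _ _ _ _ _ _ := Cell.ext (whiskerLeft_comp _ _ _)
  id_whiskerLeft _ := Cell.ext (id_whiskerLeft _)
  comp_whiskerLeft _ _ _ _ _ := Cell.ext (comp_whiskerLeft _ _ _)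
  id_whiskerRight _ _ := Cell.ext (id_whiskerRight _ _)
  comp_whiskerRight _ _ _ := Cell.ext (comp_whiskerRight _ _ _)
  whiskerRight_id _ := Cell.ext (whiskerRight_id _)
  whiskerRight_comp _ _ _ := Cell.ext (whiskerRight_comp _ _ _)
  whisker_assoc _ _ _ _ _ := Cell.ext (whisker_assoc _ _ _)
  whisker_exchange _ _ := Cell.ext (whisker_exchange _ _)
  pentagon _ _ _ _ := Cell.ext (pentagon _ _ _ _)
  triangle _ _ := Cell.ext (triangle _ _)

end Span

namespace Span

variable {X Y Z V : GrSet.{u}}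

/-- Two spans are adjoint equivalent if there is an adjoint equivalence between them in the 2-category
of spans. -/
def AdjEquiv (S T : Span X Y) : Prop := Nonempty (Bicategory.Equivalence S T)

theorem AdjEquiv.exists_isEqv {S T : Span X Y} (h : AdjEquiv S T) :
    ∃ f : S ⟶ T, IsEqv (Hom.φ f) := by
  obtain ⟨e⟩ := h
  exact ⟨e.hom, isEqv_of_cells (Cell.cell e.unit.hom) (Cell.cell e.counit.hom)⟩

theorem adjEquiv_of_isEqv {S T : Span X Y} (f : Hom S T) (hf : IsEqv f.φ) : AdjEquiv S T := by
  choose p h hp using hf.surj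
  have hact : ∀ (y : T.W.X) (k : T.W.G), ((h (k • y))⁻¹ * k * h y) • f.φ.toFun (p y) =
      f.φ.toFun (p (k • y)) := fun y k => by
    rw [mul_smul, mul_smul, hp, inv_smul_eq_iff, hp]
  choose a ha ha' using fun y k => hf.full _ _ _ (hact y k)
  let ψ : T.W ⟶ S.W := GrSet.Hom.mk p a (fun y k => (ha y k).symm) (fun y k k' => by
    refine hf.faithful (p y) _ _ ?_ ?_
    · rw [ha, mul_smul k k' y, mul_smul, ha, ha]
    · rw [f.φ.act_mul, ha', ha, ha', ha', mul_smul]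
      group)
  let counit : ψ ≫ f.φ ⟶ 𝟙 T.W := GrSet.Cell.mk' h (fun y => (hp y).symm) (fun y k => by
    change h (k • y) * f.φ.act (p y) (a y k) = k * h y
    rw [ha']
    group)
  have hu : ∀ x : S.W.X, (h (f.φ.toFun x))⁻¹ • f.φ.toFun x = f.φ.toFun (p (f.φ.toFun x)) :=
    fun x => by rw [inv_smul_eq_iff, hp]
  choose v hv hv' using fun x => hf.full _ _ _ (hu x)
  let unit : 𝟙 S.W ⟶ f.φ ≫ ψ := GrSet.Cell.mk' v (fun x => (hv x).symm) (fun x g => by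
    change v (g • x) * g = a (f.φ.toFun x) (f.φ.act x g) * v x
    refine hf.faithful x _ _ ?_ ?_
    · rw [mul_smul, mul_smul, hv, hv, ha, f.φ.map_smul]
    · rw [f.φ.act_mul, f.φ.act_mul, hv', hv', hv, ha', ← f.φ.map_smul]
      group)
  let g : Hom T S :=
    { φ := ψ
      μl := ψ ◁ (cellIso f.μl).inv ≫ (α_ ψ f.φ T.l).inv ≫ counit ▷ T.l ≫ (λ_ T.l).hom
      μr := ψ ◁ (cellIso f.μr).inv ≫ (α_ ψ f.φ T.r).inv ≫ counit ▷ T.r ≫ (λ_ T.r).hom }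
  have gl : ∀ y, g.μl.app y = T.l.act (f.φ.toFun (p y)) (h y) * (f.μl.app (p y))⁻¹ := fun y => by
    change 1 * _ * 1 * _ = _
    rw [one_mul, mul_one]
    rfl
  have gr : ∀ y, g.μr.app y = T.r.act (f.φ.toFun (p y)) (h y) * (f.μr.app (p y))⁻¹ := fun y => by
    change 1 * _ * 1 * _ = _
    rw [one_mul, mul_one]
    rfl
  refine ⟨Bicategory.Equivalence.mkOfAdjointifyCounit (f := (f : S ⟶ T)) (g := (g : T ⟶ S))
    (Cell.iso (f := Hom.id S) (f' := Hom.comp f g) (cellIso unit) (fun x => ?_) (fun x => ?_))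
    (Cell.iso (f := Hom.comp g f) (f' := Hom.id T) (cellIso counit) (fun y => ?_) (fun y => ?_))⟩
  · have hn := f.μl.nat x (v x)
    change _ * T.l.act (f.φ.toFun x) (f.φ.act x (v x)) = S.l.act x (v x) * _ at hn
    rw [Hom.comp_μl_app, gl]
    change _ * S.l.act x (v x) = 1
    rw [← mul_inv_eq_iff_eq_mul] at hn
    rw [← hn, hv, hv', ← hu x, GrSet.Hom.act_smul_inv]
    group
  · have hn := f.μr.nat x (v x)
    change _ * T.r.act (f.φ.toFun x) (f.φ.act x (v x)) = S.r.act x (v x) * _ at hn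
    rw [Hom.comp_μr_app, gr]
    change _ * S.r.act x (v x) = 1
    rw [← mul_inv_eq_iff_eq_mul] at hn
    rw [← hn, hv, hv', ← hu x, GrSet.Hom.act_smul_inv]
    group
  · rw [Hom.comp_μl_app, gl]
    change 1 * _ = _
    rw [one_mul]
    exact (inv_mul_cancel_right _ _).symm
  · rw [Hom.comp_μr_app, gr]
    change 1 * _ = _
    rw [one_mul]
    exact (inv_mul_cancel_right _ _).symm

theorem adjEquiv_iff {S T : Span X Y} : AdjEquiv S T ↔ ∃ f : Hom S T, IsEqv f.φ :=
  ⟨fun h => h.exists_isEqv, fun ⟨f, hf⟩ => adjEquiv_of_isEqv f hf⟩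

theorem AdjEquiv.refl (S : Span X Y) : AdjEquiv S S := ⟨Bicategory.Equivalence.id S⟩

theorem AdjEquiv.symm {S T : Span X Y} (h : AdjEquiv S T) : AdjEquiv T S := by
  obtain ⟨e⟩ := h
  exact ⟨Bicategory.Equivalence.mkOfAdjointifyCounit e.counit.symm e.unit.symm⟩

theorem AdjEquiv.trans {S T P : Span X Y} (h : AdjEquiv S T) (h' : AdjEquiv T P) :
    AdjEquiv S P := by
  obtain ⟨f, hf⟩ := h.exists_isEqv
  obtain ⟨g, hg⟩ := h'.exists_isEqv
  exact adjEquiv_of_isEqv (Hom.comp f g) (hf.comp hg)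

/-- Adjoint equivalence is an equivalence relation on spans. -/
@[reducible] def setoid (X Y : GrSet.{u}) : Setoid (Span X Y) :=
  ⟨AdjEquiv, AdjEquiv.refl, AdjEquiv.symm, AdjEquiv.trans⟩

end Span

/-! ### Composition of spans -/

section commaMap

variable {A B C A' B' : GrSet.{u}} {α : A ⟶ C} {β : B ⟶ C} {α' : A' ⟶ C} {β' : B' ⟶ C}

/-- The 1-cell between 2-fibered products induced by 1-cells over the base. -/
def commaMap (φ : A ⟶ A') (ψ : B ⟶ B') (m : φ ≫ α' ⟶ α) (n : ψ ≫ β' ⟶ β) :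
    comma α β ⟶ comma α' β' :=
  Hom.mk (fun p => (⟨φ.toFun (CommaX.fst p), ψ.toFun (CommaX.snd p),
      (n.app (CommaX.snd p))⁻¹ * CommaX.arr p * m.app (CommaX.fst p), by
        have h₁ := m.app_smul (CommaX.fst p)
        have h₂ := n.app_smul (CommaX.snd p)
        simp only [comp_toFun] at h₁ h₂
        rw [mul_smul, mul_smul, ← h₁, ← CommaX.eq p, h₂, inv_smul_smul]⟩ : CommaX α' β'))
    (fun p a => (φ.act (CommaX.fst p) (Prod.fst a), ψ.act (CommaX.snd p) (Prod.snd a)))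
    (fun p a => CommaX.ext (φ.map_smul _ _) (ψ.map_smul _ _) (by
      change (n.app ((Prod.snd a : B.G) • CommaX.snd p))⁻¹ *
        (β.act (CommaX.snd p) (Prod.snd a) * CommaX.arr p *
          (α.act (CommaX.fst p) (Prod.fst a))⁻¹) * m.app ((Prod.fst a : A.G) • CommaX.fst p) =
        β'.act _ (ψ.act (CommaX.snd p) (Prod.snd a)) *
          ((n.app (CommaX.snd p))⁻¹ * CommaX.arr p * m.app (CommaX.fst p)) *
          (α'.act _ (φ.act (CommaX.fst p) (Prod.fst a)))⁻¹
      have h₁ := m.nat (CommaX.fst p) (Prod.fst a)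
      have h₂ := n.nat (CommaX.snd p) (Prod.snd a)
      simp only [comp_act] at h₁ h₂
      rw [← eq_mul_inv_iff_mul_eq] at h₁ h₂
      rw [h₁, h₂]
      group))
    (fun p a a' => Prod.ext (φ.act_mul _ _ _) (ψ.act_mul _ _ _))

theorem commaMap_isFF {φ : A ⟶ A'} {ψ : B ⟶ B'} (m : φ ≫ α' ⟶ α) (n : ψ ≫ β' ⟶ β)
    (hφ : IsFF φ) (hψ : IsFF ψ) : IsFF (commaMap φ ψ m n) where
  full p p' a h := by
    have e₁ : (Prod.fst a : A'.G) • φ.toFun (CommaX.fst p) = φ.toFun (CommaX.fst p') :=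
      congrArg CommaX.fst h
    have e₂ : (Prod.snd a : B'.G) • ψ.toFun (CommaX.snd p) = ψ.toFun (CommaX.snd p') :=
      congrArg CommaX.snd h
    have e₃ : β'.act (ψ.toFun (CommaX.snd p)) (Prod.snd a) *
        ((n.app (CommaX.snd p))⁻¹ * CommaX.arr p * m.app (CommaX.fst p)) *
          (α'.act (φ.toFun (CommaX.fst p)) (Prod.fst a))⁻¹ =
        (n.app (CommaX.snd p'))⁻¹ * CommaX.arr p' * m.app (CommaX.fst p') :=
      congrArg CommaX.arr h
    obtain ⟨g, hg, hg'⟩ := hφ.full _ _ _ e₁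
    obtain ⟨k, hk, hk'⟩ := hψ.full _ _ _ e₂
    refine ⟨(g, k), CommaX.ext hg hk ?_, Prod.ext hg' hk'⟩
    change β.act (CommaX.snd p) k * CommaX.arr p * (α.act (CommaX.fst p) g)⁻¹ = CommaX.arr p'
    have h₁ := m.nat (CommaX.fst p) g
    have h₂ := n.nat (CommaX.snd p) k
    simp only [comp_act] at h₁ h₂
    rw [hg, hg', ← mul_inv_eq_iff_eq_mul] at h₁
    rw [hk, hk', ← mul_inv_eq_iff_eq_mul] at h₂
    rw [← h₁, ← h₂]
    rw [eq_comm, mul_assoc, inv_mul_eq_iff_eq_mul, ← eq_mul_inv_iff_mul_eq] at e₃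
    rw [e₃]
    group
  faithful p a a' h h' := by
    refine Prod.ext (hφ.faithful (CommaX.fst p) _ _ (congrArg CommaX.fst h) (congrArg Prod.fst h'))
      (hψ.faithful (CommaX.snd p) _ _ (congrArg CommaX.snd h) (congrArg Prod.snd h'))

theorem commaMap_surj {φ : A ⟶ A'} {ψ : B ⟶ B'} (m : φ ≫ α' ⟶ α) (n : ψ ≫ β' ⟶ β)
    (q : (comma α' β').X) (x : A.X) (h : A'.G) (hx : h • φ.toFun x = CommaX.fst q)
    (y : B.X) (k : B'.G) (hy : k • ψ.toFun y = CommaX.snd q) :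
    ∃ (p : (comma α β).X) (a : (comma α' β').G),
      CommaX.fst p = x ∧ CommaX.snd p = y ∧ a • (commaMap φ ψ m n).toFun p = q := by
  have h₁ := m.app_smul x
  have h₂ := n.app_smul y
  have h₃ := CommaX.eq q
  simp only [comp_toFun] at h₁ h₂
  rw [← hx, ← hy, α'.map_smul, β'.map_smul] at h₃
  refine ⟨(⟨x, y, n.app y * ((β'.act (ψ.toFun y) k)⁻¹ * CommaX.arr q * α'.act (φ.toFun x) h) *
    (m.app x)⁻¹, ?_⟩ : CommaX α β), (h, k), rfl, rfl, CommaX.ext hx hy ?_⟩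
  · rw [h₁, h₂, mul_smul, mul_smul, inv_smul_smul, mul_smul, mul_smul, ← h₃, inv_smul_smul]
  · change β'.act (ψ.toFun y) k * ((n.app y)⁻¹ * (n.app y * ((β'.act (ψ.toFun y) k)⁻¹ *
      CommaX.arr q * α'.act (φ.toFun x) h) * (m.app x)⁻¹) * m.app x) *
      (α'.act (φ.toFun x) h)⁻¹ = CommaX.arr q
    group

theorem commaMap_isEqv {φ : A ⟶ A'} {ψ : B ⟶ B'} (m : φ ≫ α' ⟶ α) (n : ψ ≫ β' ⟶ β)
    (hφ : IsEqv φ) (hψ : IsEqv ψ) : IsEqv (commaMap φ ψ m n) where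
  toIsFF := commaMap_isFF m n hφ.toIsFF hψ.toIsFF
  surj q := by
    obtain ⟨x, h, hx⟩ := hφ.surj (CommaX.fst q)
    obtain ⟨y, k, hy⟩ := hψ.surj (CommaX.snd q)
    obtain ⟨p, a, -, -, hp⟩ := commaMap_surj m n q x h hx y k hy
    exact ⟨p, a, hp⟩

theorem comma_snd_isEqv (β : B ⟶ C) : IsEqv (comma.snd (𝟙 C) β) := by
  have eqs : ∀ p : CommaX (𝟙 C) β, β.toFun p.snd = p.arr • p.fst := fun p => p.eq
  refine ⟨⟨fun p p' k e => ?_, fun p a a' h h' => ?_⟩, fun y => ?_⟩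
  · let g : C.G := (CommaX.arr p')⁻¹ * β.act (CommaX.snd p) k * CommaX.arr p
    have e' : k • CommaX.snd p = CommaX.snd p' := e
    refine ⟨(g, k), CommaX.ext ?_ e ?_, rfl⟩
    · change g • CommaX.fst p = CommaX.fst p'
      rw [mul_smul, mul_smul, ← eqs p, ← β.map_smul, e', eqs p', inv_smul_smul]
    · change β.act (CommaX.snd p) k * CommaX.arr p *
        ((CommaX.arr p')⁻¹ * β.act (CommaX.snd p) k * CommaX.arr p)⁻¹ = CommaX.arr p'
      group
  · have h₂ : Prod.snd a = Prod.snd a' := h'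
    have h₁ : β.act (CommaX.snd p) (Prod.snd a) * CommaX.arr p * (Prod.fst a : C.G)⁻¹ =
        β.act (CommaX.snd p) (Prod.snd a') * CommaX.arr p * (Prod.fst a' : C.G)⁻¹ :=
      congrArg CommaX.arr h
    rw [h₂] at h₁
    exact Prod.ext (inv_injective (mul_left_cancel h₁)) h₂
  · exact ⟨(⟨β.toFun y, y, 1, (one_smul _ _).symm⟩ : CommaX (𝟙 C) β), 1, one_smul _ _⟩

theorem comma_fst_isEqv (α : A ⟶ C) : IsEqv (comma.fst α (𝟙 C)) := by
  have eqs : ∀ p : CommaX α (𝟙 C), p.snd = p.arr • α.toFun p.fst := fun p => p.eq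
  refine ⟨⟨fun p p' k e => ?_, fun p a a' h h' => ?_⟩, fun y => ?_⟩
  · let g : C.G := CommaX.arr p' * α.act (CommaX.fst p) k * (CommaX.arr p)⁻¹
    have e' : k • CommaX.fst p = CommaX.fst p' := e
    refine ⟨(k, g), CommaX.ext e ?_ ?_, rfl⟩
    · change g • CommaX.snd p = CommaX.snd p'
      rw [mul_smul, mul_smul, eqs p, inv_smul_smul, ← α.map_smul, e', eqs p']
    · change CommaX.arr p' * α.act (CommaX.fst p) k * (CommaX.arr p)⁻¹ * CommaX.arr p *
        (α.act (CommaX.fst p) k)⁻¹ = CommaX.arr p'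
      group
  · have h₂ : Prod.fst a = Prod.fst a' := h'
    have h₁ : (Prod.snd a : C.G) * CommaX.arr p * (α.act (CommaX.fst p) (Prod.fst a))⁻¹ =
        (Prod.snd a' : C.G) * CommaX.arr p * (α.act (CommaX.fst p) (Prod.fst a'))⁻¹ :=
      congrArg CommaX.arr h
    rw [h₂] at h₁
    exact Prod.ext h₂ (mul_right_cancel (mul_right_cancel h₁))
  · exact ⟨(⟨y, α.toFun y, 1, (one_smul _ _).symm⟩ : CommaX α (𝟙 C)), 1, one_smul _ _⟩

variable {D E : GrSet.{u}} (a : A ⟶ C) (b : B ⟶ C) (c : B ⟶ D) (d : E ⟶ D)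

/-- The reassociation of iterated 2-fibered products. -/
def commaAssoc : comma (comma.snd a b ≫ c) d ⟶ comma a (comma.fst c d ≫ b) :=
  Hom.mk (fun p : CommaX (comma.snd a b ≫ c) d =>
      (⟨CommaX.fst p.fst, (⟨CommaX.snd p.fst, p.snd, p.arr, p.eq⟩ : CommaX c d),
        CommaX.arr p.fst, CommaX.eq p.fst⟩ : CommaX a (comma.fst c d ≫ b)))
    (fun _ (t : (A.G × B.G) × E.G) => ((t.1.1, (t.1.2, t.2)) : A.G × (B.G × E.G)))
    (fun _ _ => rfl) (fun _ _ _ => rfl)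

theorem commaAssoc_isEqv : IsEqv (commaAssoc a b c d) where
  full _ _ := fun (t : A.G × (B.G × E.G)) e =>
    ⟨(((t.1, t.2.1), t.2.2) : (A.G × B.G) × E.G), CommaX.ext
      (CommaX.ext (congrArg (fun q : CommaX a (comma.fst c d ≫ b) => q.fst) e)
        (congrArg (fun q : CommaX a (comma.fst c d ≫ b) => CommaX.fst q.snd) e)
        (congrArg (fun q : CommaX a (comma.fst c d ≫ b) => q.arr) e))
      (congrArg (fun q : CommaX a (comma.fst c d ≫ b) => CommaX.snd q.snd) e)
      (congrArg (fun q : CommaX a (comma.fst c d ≫ b) => CommaX.arr q.snd) e), rfl⟩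
  faithful _ _ _ _ e :=
    Prod.ext (Prod.ext (congrArg (fun s : A.G × (B.G × E.G) => s.1) e)
      (congrArg (fun s : A.G × (B.G × E.G) => s.2.1) e))
      (congrArg (fun s : A.G × (B.G × E.G) => s.2.2) e)
  surj := fun (q : CommaX a (comma.fst c d ≫ b)) =>
    ⟨(⟨(⟨q.fst, CommaX.fst q.snd, q.arr, q.eq⟩ : CommaX a b), CommaX.snd q.snd, CommaX.arr q.snd,
      CommaX.eq q.snd⟩ : CommaX (comma.snd a b ≫ c) d), 1, one_smul _ _⟩

end commaMap

namespace Span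

variable {X Y Z V : GrSet.{u}}

/-- The identity span. -/
@[simps] def idSpan (X : GrSet.{u}) : Span X X := ⟨X, 𝟙 X, 𝟙 X⟩

/-- The composition `T ∘ S`, through the 2-fibered product of the inner legs. -/
@[simps] def comp (T : Span Z Y) (S : Span Y X) : Span Z X where
  W := comma T.r S.l
  l := comma.fst T.r S.l ≫ T.l
  r := comma.snd T.r S.l ≫ S.r

/-- The 1-cell between compositions induced by 1-cells of spans. -/
def compMap {T T' : Span Z Y} {S S' : Span Y X} (f : Hom T T') (g : Hom S S') :
    Hom (comp T S) (comp T' S') where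
  φ := commaMap f.φ g.φ f.μr g.μl
  μl := comma.fst T.r S.l ◁ f.μl
  μr := comma.snd T.r S.l ◁ g.μr

theorem comp_congr {T T' : Span Z Y} {S S' : Span Y X} (h : AdjEquiv T T') (h' : AdjEquiv S S') :
    AdjEquiv (comp T S) (comp T' S') := by
  obtain ⟨f, hf⟩ := h.exists_isEqv
  obtain ⟨g, hg⟩ := h'.exists_isEqv
  exact adjEquiv_of_isEqv (compMap f g) (commaMap_isEqv _ _ hf hg)

theorem id_comp (S : Span Y X) : AdjEquiv (comp (idSpan Y) S) S :=
  adjEquiv_of_isEqv ⟨comma.snd (𝟙 Y) S.l, (cellIso (comma.cell (𝟙 Y) S.l)).inv, 𝟙 _⟩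
    (comma_snd_isEqv S.l)

theorem comp_id (S : Span Y X) : AdjEquiv (comp S (idSpan X)) S :=
  adjEquiv_of_isEqv ⟨comma.fst S.r (𝟙 X), 𝟙 _, comma.cell S.r (𝟙 X)⟩ (comma_fst_isEqv S.r)

theorem comp_assoc (P : Span V Z) (T : Span Z Y) (S : Span Y X) :
    AdjEquiv (comp (comp P T) S) (comp P (comp T S)) :=
  adjEquiv_of_isEqv ⟨commaAssoc P.r T.l T.r S.l, 𝟙 _, 𝟙 _⟩ (commaAssoc_isEqv P.r T.l T.r S.l)

end Span

/-! ### Sums of spans -/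

section desc

variable {A B C : GrSet.{u}}

theorem coprod.inl_isFF (A B : GrSet.{u}) : IsFF (coprod.inl A B) where
  full x x' a e := by
    obtain ⟨g, h⟩ := a
    obtain ⟨e₁, e₂⟩ := coprod.mkl_inj.mp ((coprod.smul_mkl g h x 1).symm.trans e)
    rw [mul_one] at e₂
    subst e₂
    exact ⟨g, e₁, rfl⟩
  faithful x g g' _ e := congrArg Prod.fst e

theorem coprod.inr_isFF (A B : GrSet.{u}) : IsFF (coprod.inr A B) where
  full y y' a e := by
    obtain ⟨g, h⟩ := a
    obtain ⟨e₁, e₂⟩ := coprod.mkr_inj.mp ((coprod.smul_mkr g h 1 y).symm.trans e)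
    rw [mul_one] at e₁
    subst e₁
    exact ⟨h, e₂, rfl⟩
  faithful x g g' _ e := congrArg Prod.snd e

theorem coprod.desc_isFF {f : A ⟶ C} {f' : B ⟶ C} (hf : IsFF f) (hf' : IsFF f')
    (hd : ∀ x y (h : C.G), h • f.toFun x ≠ f'.toFun y) : IsFF (coprod.desc f f') where
  full p p' c e := by
    induction p using coprod.ind with
    | hl x k =>
      induction p' using coprod.ind with
      | hl x' k' =>
        obtain ⟨g, rfl, rfl⟩ := hf.full x x' c e
        exact ⟨coprod.mkG g (k' * k⁻¹), by rw [coprod.smul_mkl, inv_mul_cancel_right], rfl⟩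
      | hr k' y' => exact (hd _ _ _ e).elim
    | hr k y =>
      induction p' using coprod.ind with
      | hl x' k' => exact (hd _ _ _ (inv_smul_eq_iff.mpr (Eq.symm e))).elim
      | hr k' y' =>
        obtain ⟨h, rfl, rfl⟩ := hf'.full y y' c e
        exact ⟨coprod.mkG (k' * k⁻¹) h, by rw [coprod.smul_mkr, inv_mul_cancel_right], rfl⟩
  faithful p a a' e e' := by
    obtain ⟨g, h⟩ := a
    obtain ⟨g', h'⟩ := a'
    induction p using coprod.ind with
    | hl x k =>
      obtain ⟨e₁, e₂⟩ := coprod.mkl_inj.mp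
        ((coprod.smul_mkl g h x k).symm.trans (e.trans (coprod.smul_mkl g' h' x k)))
      exact Prod.ext (hf.faithful x g g' e₁ e') (mul_right_cancel e₂)
    | hr k y =>
      obtain ⟨e₁, e₂⟩ := coprod.mkr_inj.mp
        ((coprod.smul_mkr g h k y).symm.trans (e.trans (coprod.smul_mkr g' h' k y)))
      exact Prod.ext (mul_right_cancel e₁) (hf'.faithful y h h' e₂ e')

/-- The 2-cell between 1-cells out of a coproduct given by two 2-cells on the summands. -/
def coprod.descCell {P : GrSet.{u}} {f : A ⟶ C} {f' : B ⟶ C} {a : C ⟶ P} {b : A ⟶ P} {b' : B ⟶ P}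
    (m : f ≫ a ⟶ b) (m' : f' ≫ a ⟶ b') : coprod.desc f f' ≫ a ⟶ coprod.desc b b' :=
  Cell.mk' (Sum.elim (fun p => m.app p.1) (fun p => m'.app p.2))
    (coprod.ind (fun x _ => m.app_smul x) (fun _ y => m'.app_smul y))
    (coprod.ind (fun x _ a => m.nat x a.1) (fun _ y a => m'.nat y a.2))

end desc

/-- The unique 2-cell between two 1-cells out of the empty 0-cell. -/
def emptyCell {A : GrSet.{u}} (f f' : empty ⟶ A) : f ⟶ f' :=
  Cell.mk' (fun x => isEmptyElim x) (fun x => isEmptyElim x) (fun x => isEmptyElim x)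

namespace Span

variable {X Y Z V : GrSet.{u}}

/-- The zero span, through the empty 0-cell. -/
@[simps] def zero (X Y : GrSet.{u}) : Span X Y := ⟨empty, fromEmpty X, fromEmpty Y⟩

instance : IsEmpty (zero X Y).W.X := inferInstanceAs (IsEmpty empty.X)

/-- The sum of two spans: the 2-coproduct. -/
@[simps] def sum (S T : Span X Y) : Span X Y where
  W := coprod S.W T.W
  l := coprod.desc S.l T.l
  r := coprod.desc S.r T.r

/-- The first coprojection. -/
def sumInl (S T : Span X Y) : Hom S (sum S T) := ⟨coprod.inl _ _, 𝟙 S.l, 𝟙 S.r⟩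

/-- The second coprojection. -/
def sumInr (S T : Span X Y) : Hom T (sum S T) := ⟨coprod.inr _ _, 𝟙 T.l, 𝟙 T.r⟩

/-- The 1-cell out of a sum. -/
def sumDesc {S T P : Span X Y} (i : Hom S P) (j : Hom T P) : Hom (sum S T) P :=
  ⟨coprod.desc i.φ j.φ, coprod.descCell i.μl j.μl, coprod.descCell i.μr j.μr⟩

/-- `P` is covered by two disjoint fully faithful 1-cells of spans. -/
structure IsSum {S T P : Span X Y} (i : Hom S P) (j : Hom T P) : Prop where
  left : IsFF i.φ
  right : IsFF j.φ
  disj : ∀ x y (h : P.W.G), h • i.φ.toFun x ≠ j.φ.toFun y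
  cover : ∀ p, (∃ (x : S.W.X) (h : P.W.G), h • i.φ.toFun x = p) ∨
    (∃ (y : T.W.X) (h : P.W.G), h • j.φ.toFun y = p)

theorem IsSum.adjEquiv {S T P : Span X Y} {i : Hom S P} {j : Hom T P} (h : IsSum i j) :
    AdjEquiv (sum S T) P :=
  adjEquiv_of_isEqv (sumDesc i j)
    { toIsFF := coprod.desc_isFF h.left h.right h.disj
      surj := fun p => by
        rcases h.cover p with ⟨x, k, hx⟩ | ⟨y, k, hy⟩
        exacts [⟨coprod.mkl x 1, k, hx⟩, ⟨coprod.mkr 1 y, k, hy⟩] }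

theorem isSum_sum (S T : Span X Y) : IsSum (sumInl S T) (sumInr S T) where
  left := coprod.inl_isFF _ _
  right := coprod.inr_isFF _ _
  disj x y h := fun e => by
    obtain ⟨g, k⟩ := h
    exact coprod.mkl_ne_mkr _ _ _ _ ((coprod.smul_mkl g k x 1).symm.trans e)
  cover := coprod.ind
    (fun x k => Or.inl ⟨x, coprod.mkG 1 k, by
      refine (coprod.smul_mkl 1 k x 1).trans ?_
      rw [one_smul, mul_one]⟩)
    (fun k y => Or.inr ⟨y, coprod.mkG k 1, by
      refine (coprod.smul_mkr k 1 1 y).trans ?_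
      rw [one_smul, mul_one]⟩)

theorem IsSum.symm {S T P : Span X Y} {i : Hom S P} {j : Hom T P} (h : IsSum i j) : IsSum j i :=
  ⟨h.right, h.left, fun y x k e => h.disj x y k⁻¹ (inv_smul_eq_iff.mpr e.symm),
    fun p => (h.cover p).symm⟩

theorem IsSum.comp {S T P S' T' : Span X Y} {i : Hom S P} {j : Hom T P} (h : IsSum i j)
    {f : Hom S' S} {g : Hom T' T} (hf : IsEqv f.φ) (hg : IsEqv g.φ) :
    IsSum (Hom.comp f i) (Hom.comp g j) where
  left := hf.toIsFF.comp h.left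
  right := hg.toIsFF.comp h.right
  disj x y k := h.disj _ _ k
  cover p := by
    rcases h.cover p with ⟨x, k, rfl⟩ | ⟨y, k, rfl⟩
    · obtain ⟨x', k', rfl⟩ := hf.surj x
      exact Or.inl ⟨x', k * i.φ.act _ k', by rw [i.φ.map_smul, mul_smul]; rfl⟩
    · obtain ⟨y', k', rfl⟩ := hg.surj y
      exact Or.inr ⟨y', k * j.φ.act _ k', by rw [j.φ.map_smul, mul_smul]; rfl⟩

theorem sum_congr {S S' T T' : Span X Y} (h : AdjEquiv S S') (h' : AdjEquiv T T') :
    AdjEquiv (sum S T) (sum S' T') := by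
  obtain ⟨f, hf⟩ := h.exists_isEqv
  obtain ⟨g, hg⟩ := h'.exists_isEqv
  exact ((isSum_sum S' T').comp (f := f) (g := g) hf hg).adjEquiv

theorem sum_comm (S T : Span X Y) : AdjEquiv (sum S T) (sum T S) :=
  (isSum_sum T S).symm.adjEquiv

theorem zero_sum (S : Span X Y) : AdjEquiv (sum (zero X Y) S) S := by
  let i : Hom (zero X Y) S := ⟨fromEmpty S.W,
    emptyCell _ _, emptyCell _ _⟩
  exact IsSum.adjEquiv (i := i) (j := Hom.id S)
    ⟨⟨isEmptyElim, isEmptyElim⟩, IsFF.id _, isEmptyElim, fun p => Or.inr ⟨p, 1, one_smul _ _⟩⟩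

theorem sum_assoc (S T P : Span X Y) : AdjEquiv (sum (sum S T) P) (sum S (sum T P)) := by
  have h₁ := isSum_sum S (sum T P)
  have h₂ := isSum_sum T P
  refine IsSum.adjEquiv (i := sumDesc (sumInl S (sum T P)) (Hom.comp (sumInl T P) (sumInr S _)))
    (j := Hom.comp (sumInr T P) (sumInr S _))
    ⟨coprod.desc_isFF h₁.left (h₂.left.comp h₁.right) (fun x y k => h₁.disj _ _ k),
      h₂.right.comp h₁.right, coprod.ind (fun x _ y k => h₁.disj _ _ k) (fun _ x y k e => ?_),
      fun p => ?_⟩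
  · obtain ⟨g, hg, -⟩ := h₁.right.full _ _ _ e
    exact h₂.disj _ _ _ hg
  · rcases h₁.cover p with ⟨x, k, hx⟩ | ⟨y, k, rfl⟩
    · exact Or.inl ⟨coprod.mkl x 1, k, hx⟩
    · rcases h₂.cover y with ⟨x, k', rfl⟩ | ⟨z, k', rfl⟩
      · exact Or.inl ⟨coprod.mkr 1 x, k * (sumInr S (sum T P)).φ.act _ k', by
          rw [(sumInr S (sum T P)).φ.map_smul, mul_smul]; rfl⟩
      · exact Or.inr ⟨z, k * (sumInr S (sum T P)).φ.act _ k', by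
          rw [(sumInr S (sum T P)).φ.map_smul, mul_smul]; rfl⟩

theorem adjEquiv_zero (S : Span X Y) (h : IsEmpty S.W.X) : AdjEquiv (zero X Y) S :=
  adjEquiv_of_isEqv ⟨fromEmpty S.W,
    emptyCell _ _, emptyCell _ _⟩
    ⟨⟨isEmptyElim, isEmptyElim⟩, fun p => h.elim p⟩

theorem sum_comp (T T' : Span Z Y) (S : Span Y X) :
    AdjEquiv (sum (comp T S) (comp T' S)) (comp (sum T T') S) := by
  have h := isSum_sum T T'
  refine IsSum.adjEquiv (i := compMap (sumInl T T') (Hom.id S))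
    (j := compMap (sumInr T T') (Hom.id S))
    ⟨commaMap_isFF _ _ h.left (IsFF.id _), commaMap_isFF _ _ h.right (IsFF.id _),
      fun p q k e => h.disj _ _ _ (congrArg CommaX.fst e), fun p => ?_⟩
  rcases h.cover (CommaX.fst p) with ⟨x, k, hx⟩ | ⟨x, k, hx⟩
  · obtain ⟨q, a, -, -, hq⟩ := commaMap_surj (sumInl T T').μr (Hom.id S).μl p x k hx
      (CommaX.snd p) 1 (one_smul _ _)
    exact Or.inl ⟨q, a, hq⟩
  · obtain ⟨q, a, -, -, hq⟩ := commaMap_surj (sumInr T T').μr (Hom.id S).μl p x k hx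
      (CommaX.snd p) 1 (one_smul _ _)
    exact Or.inr ⟨q, a, hq⟩

theorem comp_sum (T : Span Z Y) (S S' : Span Y X) :
    AdjEquiv (sum (comp T S) (comp T S')) (comp T (sum S S')) := by
  have h := isSum_sum S S'
  refine IsSum.adjEquiv (i := compMap (Hom.id T) (sumInl S S'))
    (j := compMap (Hom.id T) (sumInr S S'))
    ⟨commaMap_isFF _ _ (IsFF.id _) h.left, commaMap_isFF _ _ (IsFF.id _) h.right,
      fun p q k e => h.disj _ _ _ (congrArg CommaX.snd e), fun p => ?_⟩
  rcases h.cover (CommaX.snd p) with ⟨x, k, hx⟩ | ⟨x, k, hx⟩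
  · obtain ⟨q, a, -, -, hq⟩ := commaMap_surj (Hom.id T).μr (sumInl S S').μl p
      (CommaX.fst p) 1 (one_smul _ _) x k hx
    exact Or.inl ⟨q, a, hq⟩
  · obtain ⟨q, a, -, -, hq⟩ := commaMap_surj (Hom.id T).μr (sumInr S S').μl p
      (CommaX.fst p) 1 (one_smul _ _) x k hx
    exact Or.inr ⟨q, a, hq⟩

end Span

end GrSet

open GrSet

/-! ### The span category -/

/-- The span category `Sp`: its objects are the 0-cells, and a morphism from `X/G` to `Y/H` is an
adjoint equivalence class of spans to `Y/H` from `X/G`. -/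
structure Sp : Type (u + 1) where
  /-- the underlying 0-cell -/
  as : GrSet.{u}

namespace Sp

/-- Morphisms of the span category. -/
def Hom (A B : Sp.{u}) : Type (u + 1) := Quotient (Span.setoid B.as A.as)

/-- The adjoint equivalence class of a span. -/
def cls {A B : Sp.{u}} (S : Span B.as A.as) : Hom A B := Quotient.mk (Span.setoid B.as A.as) S

theorem cls_eq_iff {A B : Sp.{u}} {S T : Span B.as A.as} : cls S = cls T ↔ S.AdjEquiv T :=
  Quotient.eq (r := Span.setoid B.as A.as)

theorem Hom.exists_rep {A B : Sp.{u}} (f : Hom A B) : ∃ S : Span B.as A.as, cls S = f :=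
  Quotient.exists_rep (s := Span.setoid B.as A.as) f

/-- Composition in the span category, by composing representatives. -/
def Hom.comp {A B C : Sp.{u}} (f : Hom A B) (g : Hom B C) : Hom A C :=
  Quotient.map₂ (sa := Span.setoid B.as A.as) (sb := Span.setoid C.as B.as)
    (sc := Span.setoid C.as A.as) (fun S T => Span.comp T S)
    (fun _ _ h _ _ h' => Span.comp_congr h' h) f g

theorem cls_comp {A B C : Sp.{u}} (S : Span B.as A.as) (T : Span C.as B.as) :
    Hom.comp (cls S) (cls T) = cls (Span.comp T S) := rfl

instance : Category.{u + 1} Sp.{u} where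
  Hom A B := Hom A B
  id A := cls (Span.idSpan A.as)
  comp f g := Hom.comp f g
  id_comp f := by
    obtain ⟨S, rfl⟩ := Hom.exists_rep f
    exact cls_eq_iff.mpr S.comp_id
  comp_id f := by
    obtain ⟨S, rfl⟩ := Hom.exists_rep f
    exact cls_eq_iff.mpr S.id_comp
  assoc f g h := by
    obtain ⟨S, rfl⟩ := Hom.exists_rep f
    obtain ⟨T, rfl⟩ := Hom.exists_rep g
    obtain ⟨P, rfl⟩ := Hom.exists_rep h
    exact cls_eq_iff.mpr (Span.comp_assoc P T S).symm

/-- The morphism `X/G ⟶ Y/H` of the span category given by a span to `Y/H` from `X/G`. -/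
def ofSpan {X Y : GrSet.{u}} (S : Span Y X) : (⟨X⟩ : Sp.{u}) ⟶ ⟨Y⟩ := cls S

theorem exists_ofSpan {X Y : GrSet.{u}} (f : (⟨X⟩ : Sp.{u}) ⟶ ⟨Y⟩) : ∃ S, ofSpan S = f :=
  Hom.exists_rep f

theorem ofSpan_eq_iff {X Y : GrSet.{u}} {S T : Span Y X} : ofSpan S = ofSpan T ↔ S.AdjEquiv T :=
  cls_eq_iff

theorem ofSpan_id (X : GrSet.{u}) : ofSpan (Span.idSpan X) = 𝟙 _ := rfl

theorem ofSpan_comp {X Y Z : GrSet.{u}} (T : Span Z Y) (S : Span Y X) :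
    ofSpan (Span.comp T S) = ofSpan S ≫ ofSpan T := rfl

/-- Addition of morphisms of the span category, by the sum of representatives. -/
def Hom.add {A B : Sp.{u}} (f g : Hom A B) : Hom A B :=
  Quotient.map₂ (sa := Span.setoid B.as A.as) (sb := Span.setoid B.as A.as)
    (sc := Span.setoid B.as A.as) Span.sum (fun _ _ h _ _ h' => Span.sum_congr h h') f g

instance (A B : Sp.{u}) : Add (A ⟶ B) := ⟨fun f g => Hom.add f g⟩

instance (A B : Sp.{u}) : Zero (A ⟶ B) := ⟨cls (Span.zero B.as A.as)⟩

/-- The sum of spans makes the set of morphisms of the span category a commutative monoid. -/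
instance (A B : Sp.{u}) : AddCommMonoid (A ⟶ B) where
  add_assoc f g h := by
    obtain ⟨S, rfl⟩ := Hom.exists_rep f
    obtain ⟨T, rfl⟩ := Hom.exists_rep g
    obtain ⟨P, rfl⟩ := Hom.exists_rep h
    exact cls_eq_iff.mpr (Span.sum_assoc S T P)
  zero_add f := by
    obtain ⟨S, rfl⟩ := Hom.exists_rep f
    exact cls_eq_iff.mpr S.zero_sum
  add_zero f := by
    obtain ⟨S, rfl⟩ := Hom.exists_rep f
    exact cls_eq_iff.mpr ((Span.sum_comm S (Span.zero _ _)).trans S.zero_sum)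
  add_comm f g := by
    obtain ⟨S, rfl⟩ := Hom.exists_rep f
    obtain ⟨T, rfl⟩ := Hom.exists_rep g
    exact cls_eq_iff.mpr (Span.sum_comm S T)
  nsmul := nsmulRec

variable {A B C : Sp.{u}}

theorem ofSpan_sum {X Y : GrSet.{u}} (S T : Span Y X) :
    ofSpan (Span.sum S T) = ofSpan S + ofSpan T := rfl

theorem ofSpan_zero (X Y : GrSet.{u}) : ofSpan (Span.zero Y X) = 0 := rfl

theorem add_comp (f f' : A ⟶ B) (g : B ⟶ C) : (f + f') ≫ g = f ≫ g + f' ≫ g := by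
  obtain ⟨S, rfl⟩ := Hom.exists_rep f
  obtain ⟨S', rfl⟩ := Hom.exists_rep f'
  obtain ⟨T, rfl⟩ := Hom.exists_rep g
  exact cls_eq_iff.mpr (Span.comp_sum T S S').symm

theorem comp_add (f : A ⟶ B) (g g' : B ⟶ C) : f ≫ (g + g') = f ≫ g + f ≫ g' := by
  obtain ⟨S, rfl⟩ := Hom.exists_rep f
  obtain ⟨T, rfl⟩ := Hom.exists_rep g
  obtain ⟨T', rfl⟩ := Hom.exists_rep g'
  exact cls_eq_iff.mpr (Span.sum_comp T T' S).symm

theorem zero_comp (g : B ⟶ C) : (0 : A ⟶ B) ≫ g = 0 := by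
  obtain ⟨T, rfl⟩ := Hom.exists_rep g
  exact cls_eq_iff.mpr (Span.adjEquiv_zero _
    ⟨fun p => isEmptyElim (α := GrSet.empty.X) (CommaX.snd p)⟩).symm

theorem comp_zero (f : A ⟶ B) : f ≫ (0 : B ⟶ C) = 0 := by
  obtain ⟨S, rfl⟩ := Hom.exists_rep f
  exact cls_eq_iff.mpr (Span.adjEquiv_zero _
    ⟨fun p => isEmptyElim (α := GrSet.empty.X) (CommaX.fst p)⟩).symm

variable (A B C) in
/-- Composition in the span category is biadditive. -/
def compHom : (A ⟶ B) →+ (B ⟶ C) →+ (A ⟶ C) where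
  toFun f :=
    { toFun := fun g => f ≫ g
      map_zero' := comp_zero f
      map_add' := comp_add f }
  map_zero' := AddMonoidHom.ext zero_comp
  map_add' f f' := AddMonoidHom.ext (add_comp f f')

end Sp

/-! ### The group completion of the span category -/

open Algebra (GrothendieckAddGroup)

/-- The category `𝒯`: it has the objects of `Sp`, and its groups of morphisms are the group
completions of the monoids of morphisms of `Sp`. -/
structure Tcal : Type (u + 1) where
  /-- the underlying 0-cell -/
  as : GrSet.{u}

namespace Tcal

/-- Morphisms of `𝒯`. -/
def Hom (A B : Tcal.{u}) : Type (u + 1) :=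
  GrothendieckAddGroup ((⟨A.as⟩ : Sp.{u}) ⟶ ⟨B.as⟩)

noncomputable instance (A B : Tcal.{u}) : AddCommGroup (Hom A B) :=
  inferInstanceAs (AddCommGroup (GrothendieckAddGroup _))

/-- The canonical homomorphism to the group completion. -/
def of {A B : GrSet.{u}} : ((⟨A⟩ : Sp.{u}) ⟶ ⟨B⟩) →+ Hom ⟨A⟩ ⟨B⟩ := GrothendieckAddGroup.of

variable {A B C : GrSet.{u}}

theorem addHom_ext {M : Type*} [AddCommGroup M] {f g : Hom ⟨A⟩ ⟨B⟩ →+ M}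
    (h : ∀ s, f (of s) = g (of s)) : f = g :=
  GrothendieckAddGroup.lift.symm.injective (AddMonoidHom.ext h)

/-- A homomorphism to a group extends to the group completion. -/
noncomputable def lift {M : Type*} [AddCommGroup M] (f : ((⟨A⟩ : Sp.{u}) ⟶ ⟨B⟩) →+ M) :
    Hom ⟨A⟩ ⟨B⟩ →+ M := GrothendieckAddGroup.lift f

@[simp] theorem lift_of {M : Type*} [AddCommGroup M] (f : ((⟨A⟩ : Sp.{u}) ⟶ ⟨B⟩) →+ M) (s) :
    lift f (of s) = f s :=
  DFunLike.congr_fun (GrothendieckAddGroup.lift.symm_apply_apply f) s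

variable (A B C) in
/-- The biadditive extension of the composition of `Sp`. -/
noncomputable def compHom : Hom ⟨A⟩ ⟨B⟩ →+ Hom ⟨B⟩ ⟨C⟩ →+ Hom ⟨A⟩ ⟨C⟩ :=
  lift
    { toFun := fun s => lift (of.comp (Sp.compHom ⟨A⟩ ⟨B⟩ ⟨C⟩ s))
      map_zero' := addHom_ext fun t => by simp
      map_add' := fun s s' => addHom_ext fun t => by simp }

@[simp] theorem compHom_of (s : (⟨A⟩ : Sp.{u}) ⟶ ⟨B⟩) (t : (⟨B⟩ : Sp.{u}) ⟶ ⟨C⟩) :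
    compHom A B C (of s) (of t) = of (s ≫ t) := by
  simp [compHom, Sp.compHom]

theorem exists_eq_sub (x : Hom ⟨A⟩ ⟨B⟩) : ∃ s t, x = of s - of t := by
  induction x using AddLocalization.ind with
  | _ p =>
    refine ⟨p.1, p.2, ?_⟩
    exact (AddLocalization.mk_eq_addMonoidOf_mk'_apply p.1 p.2).trans
      (eq_sub_of_add_eq (AddSubmonoid.LocalizationMap.mk'_spec _ _ _))

noncomputable instance : Category.{u + 1} Tcal.{u} where
  Hom A B := Hom A B
  id A := of (𝟙 (⟨A.as⟩ : Sp.{u}))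
  comp {A B C} f g := compHom A.as B.as C.as f g
  id_comp {A B} f := by
    obtain ⟨s, t, rfl⟩ := exists_eq_sub f
    simp
  comp_id {A B} f := by
    obtain ⟨s, t, rfl⟩ := exists_eq_sub f
    simp
  assoc {A B C D} f g h := by
    obtain ⟨s, t, rfl⟩ := exists_eq_sub f
    obtain ⟨s', t', rfl⟩ := exists_eq_sub g
    obtain ⟨s'', t'', rfl⟩ := exists_eq_sub h
    simp

/-- The canonical functor `c : Sp ⥤ 𝒯`. -/
noncomputable def c : Sp.{u} ⥤ Tcal.{u} where
  obj A := ⟨A.as⟩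
  map f := of f
  map_id _ := rfl
  map_comp f g := (compHom_of f g).symm

end Tcal

/-! ### Mackey functors -/

open Limits

/-- A semi-Mackey functor on the 2-category of finite sets with group actions, with values in a
category with finite products: a contravariant 2-functor (`res`) and a covariant 2-functor (`tr`)
with the same values on 0-cells (2-cells are sent to equalities), satisfying additivity and the
Mackey condition. -/
structure SemiMackey (D : Type d) [Category.{v} D] [HasFiniteProducts D] :
    Type (max (u + 1) d v) where
  /-- the value on a 0-cell -/
  obj : GrSet.{u} → D
  /-- the contravariant part -/
  res {A B : GrSet.{u}} (f : A ⟶ B) : obj B ⟶ obj A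
  /-- the covariant part -/
  tr {A B : GrSet.{u}} (f : A ⟶ B) : obj A ⟶ obj B
  res_id (A : GrSet.{u}) : res (𝟙 A) = 𝟙 (obj A)
  res_comp {A B C : GrSet.{u}} (f : A ⟶ B) (g : B ⟶ C) : res (f ≫ g) = res g ≫ res f
  res_cell {A B : GrSet.{u}} {f f' : A ⟶ B} (η : f ⟶ f') : res f = res f'
  tr_id (A : GrSet.{u}) : tr (𝟙 A) = 𝟙 (obj A)
  tr_comp {A B C : GrSet.{u}} (f : A ⟶ B) (g : B ⟶ C) : tr (f ≫ g) = tr f ≫ tr g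
  tr_cell {A B : GrSet.{u}} {f f' : A ⟶ B} (η : f ⟶ f') : tr f = tr f'
  /-- the natural morphism `M(A ⊔ B) → M(A) × M(B)` is an isomorphism -/
  additive {A B P : GrSet.{u}} (i : A ⟶ P) (j : B ⟶ P) :
    IsTwoCoproduct i j → IsIso (prod.lift (res i) (res j))
  /-- `M(∅)` is terminal -/
  additive_empty (A : GrSet.{u}) : IsEmpty A.X → Nonempty (IsTerminal (obj A))
  /-- `M^*(α) ∘ M_*(β) = M_*(γ) ∘ M^*(δ)` for every 2-fibered product -/
  mackey {W A B C : GrSet.{u}} (γ : W ⟶ A) (δ : W ⟶ B) (α : A ⟶ C) (β : B ⟶ C)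
    (κ : γ ≫ α ⟶ δ ≫ β) : IsTwoPullback γ δ α β κ → tr β ≫ res α = res δ ≫ tr γ

namespace SemiMackey

section

variable {D : Type d} [Category.{v} D] [HasFiniteProducts D]

/-- A morphism of semi-Mackey functors. -/
@[ext]
structure Hom (M N : SemiMackey.{u} D) : Type (max (u + 1) v) where
  app (A : GrSet.{u}) : M.obj A ⟶ N.obj A
  res_app {A B : GrSet.{u}} (f : A ⟶ B) : M.res f ≫ app A = app B ≫ N.res f
  tr_app {A B : GrSet.{u}} (f : A ⟶ B) : M.tr f ≫ app B = app A ≫ N.tr f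

/-- The category of semi-Mackey functors. -/
instance : Category.{max (u + 1) v} (SemiMackey.{u} D) where
  Hom M N := Hom M N
  id M := ⟨fun A => 𝟙 (M.obj A), fun f => by simp, fun f => by simp⟩
  comp φ ψ := ⟨fun A => φ.app A ≫ ψ.app A,
    fun f => by rw [← Category.assoc, φ.res_app, Category.assoc, ψ.res_app, Category.assoc],
    fun f => by rw [← Category.assoc, φ.tr_app, Category.assoc, ψ.tr_app, Category.assoc]⟩
  id_comp _ := Hom.ext (funext fun _ => Category.id_comp _)
  comp_id _ := Hom.ext (funext fun _ => Category.comp_id _)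
  assoc _ _ _ := Hom.ext (funext fun _ => Category.assoc _ _ _)

end

/-! For set-valued semi-Mackey functors, `M(X/G)` is a commutative monoid. -/

variable (M : SemiMackey.{u} (Type w))

theorem bijective_res {A B P : GrSet.{u}} (i : A ⟶ P) (j : B ⟶ P) (h : IsTwoCoproduct i j) :
    Function.Bijective (fun m : M.obj P => (M.res i m, M.res j m)) := by
  have := M.additive i j h
  have hb := (isIso_iff_bijective (prod.lift (M.res i) (M.res j) ≫
    (Types.binaryProductIso (M.obj A) (M.obj B)).hom)).mp inferInstance
  convert hb using 1
  funext m
  refine Prod.ext ?_ ?_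
  · have h1 := congrArg (fun k => prod.lift (M.res i) (M.res j) ≫ k)
      (Types.binaryProductIso_hom_comp_fst (M.obj A) (M.obj B))
    exact (ConcreteCategory.congr_hom (h1.trans (prod.lift_fst _ _)) m).symm
  · have h1 := congrArg (fun k => prod.lift (M.res i) (M.res j) ≫ k)
      (Types.binaryProductIso_hom_comp_snd (M.obj A) (M.obj B))
    exact (ConcreteCategory.congr_hom (h1.trans (prod.lift_snd _ _)) m).symm

/-- The addition `M(A) × M(A) ≅ M(A ⊔ A) → M(A)`, through the folding map. -/
noncomputable def add {A : GrSet.{u}} (m n : M.obj A) : M.obj A :=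
  M.tr (double.fold A)
    ((Equiv.ofBijective _ (M.bijective_res _ _ (double.isTwoCoproduct A))).symm (m, n))

/-- The unit for the addition: the image of `M(∅) → M(A)`. -/
noncomputable def zero (A : GrSet.{u}) : M.obj A :=
  M.tr (fromEmpty A) (((Types.isTerminalEquivUnique _)
    (M.additive_empty empty inferInstance).some).default)

/-- A semi-Mackey functor is a Mackey functor if all monoids `M(X/G)` are groups. -/
def IsMackey : ObjectProperty (SemiMackey.{u} (Type w)) := fun M =>
  ∀ (A : GrSet.{u}) (m : M.obj A), ∃ n : M.obj A, M.add m n = M.zero A ∧ M.add n m = M.zero A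

end SemiMackey

/-- The category of semi-Mackey functors. -/
abbrev SMack : Type (max (u + 1) (w + 1)) := SemiMackey.{u} (Type w)

/-- The category of Mackey functors, a full subcategory of that of semi-Mackey functors. -/
abbrev Mack : Type (max (u + 1) (w + 1)) := SemiMackey.IsMackey.{u, w}.FullSubcategory

/-- The category of `R`-linear Mackey functors. -/
abbrev MackLin (R : Type r) [CommRing R] : Type (max (u + 1) (w + 1) r) :=
  SemiMackey.{u} (ModuleCat.{w} R)

/-- The property of preserving finite products. -/
def preservesFiniteProducts (C : Type c) [Category.{v2} C] (D : Type d) [Category.{v} D] :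
    ObjectProperty (C ⥤ D) := fun F => PreservesFiniteProducts F

/-- The category of functors preserving finite products. -/
abbrev AddFun (C : Type c) [Category.{v2} C] (D : Type d) [Category.{v} D] :=
  (preservesFiniteProducts C D).FullSubcategory

/-- A functor `Φ` from a category of semi-Mackey functors to functors on the span category is given
by `Φ(M)(X/G) = M(X/G)` and `Φ(M)([S]) = M_*(α_S) ∘ M^*(β_S)`, naturally in `M`. -/
def IsSpanCorrespondence {D : Type d} [Category.{v} D] [HasFiniteProducts D]
    (Φ : SemiMackey.{u} D ⥤ (Sp.{u} ⥤ D)) : Prop :=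
  ∃ e : ∀ (M : SemiMackey.{u} D) (A : GrSet.{u}), (Φ.obj M).obj ⟨A⟩ ≅ M.obj A,
    (∀ (M : SemiMackey.{u} D) {A B : GrSet.{u}} (S : Span B A),
      (Φ.obj M).map (Sp.ofSpan S) ≫ (e M B).hom = (e M A).hom ≫ M.res S.r ≫ M.tr S.l) ∧
    ∀ {M N : SemiMackey.{u} D} (φ : M ⟶ N) (A : GrSet.{u}),
      (Φ.map φ).app ⟨A⟩ ≫ (e N A).hom = (e M A).hom ≫ φ.app A

/-- Composition with the canonical functor `c : Sp ⥤ 𝒯`. -/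
noncomputable abbrev precompC (D : Type d) [Category.{v} D] : (Tcal.{u} ⥤ D) ⥤ (Sp.{u} ⥤ D) :=
  (Functor.whiskeringLeft _ _ _).obj Tcal.c

end BisetMackey

/-! Every span is a restriction followed by a transfer: `Sp.res_comp_tr_span` factors `[S]` into the
class of its right leg read backwards and the class of its left leg. So a functor on `Sp` is
determined by its values on the two kinds of generators `Sp.res` and `Sp.tr`, and naturality need
only be tested there. Conversely, the morphism `M_*(α_S) ∘ M^*(β_S)` depends only on `[S]`: an
equivalence `φ` paired with itself is a 2-fibered product of two identities, so the Mackey condition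
gives `M_*(φ) ∘ M^*(φ) = 1`, and such a factor cancels in the middle (`SemiMackey.spanMap_congr`).
It respects composition by the Mackey condition for the standard 2-fibered product
(`SemiMackey.spanMap_comp`). In the other direction, the axioms of a semi-Mackey functor already
hold in `Sp`: the Mackey condition because 2-fibered products are unique up to adjoint equivalence
(`Sp.mackey`), additivity because 2-coproducts become biproducts (`Sp.isBiprod`).

The passage to `𝒯` rests on the commutative monoid structure that a product-preserving functor `F`
on `Sp` puts on its values. It is expressed on generalized elements `X ⟶ F.obj A` (`Sp.Pt`), so that
it makes sense in any target category. Addition is defined by folding, and `Sp.Pt.map_add` says that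
`F` turns sums of spans into this addition. If all these monoids are groups (`Sp.IsGrouplike`), `F`
extends to the group completion (`Tcal.extend`). Conversely, the restriction to `Sp` of a
product-preserving functor on `𝒯` is grouplike, since the negative of the identity acts as an
inverse. Natural transformations are additive, so naturality on `Sp` passes to differences
(`Tcal.liftNatTrans`).

Product-preserving functors on `𝒯` are therefore the grouplike ones on `Sp`
(`Tcal.extendFunctor_isEquivalence`). For sets, grouplike means Mackey
(`SemiMackey.isMackey_iff_isGrouplike`); for a preadditive target such as modules it is automatic
(`Sp.isGrouplike_of_preadditive`). Both statements about `𝒯` are thus instances of one construction.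
-/

namespace BisetMackey

open CategoryTheory Bicategory Limits GrSet

/-! ### Fully faithful 1-cells, and uniqueness of 2-fibered products and 2-coproducts. -/

namespace GrSet

variable {A B C P Q : GrSet.{u}}

/-- 2-cells lift uniquely along a fully faithful 1-cell. -/
theorem IsFF.exists_whiskerRight_eq {f : B ⟶ C} (hf : IsFF f) {g g' : A ⟶ B}
    (θ : g ≫ f ⟶ g' ≫ f) : ∃ ζ : g ⟶ g', ζ ▷ f = θ := by
  choose a ha ha' using fun x => hf.full (g.toFun x) (g'.toFun x) (θ.app x) (θ.app_smul x).symm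
  refine ⟨Cell.mk' a (fun x => (ha x).symm) fun x k => ?_, cell_ext ha'⟩
  have h := θ.nat x k
  simp only [comp_act] at h
  -- Fullness chose the components; faithfulness makes them natural, since both sides move `g.toFun
  -- x` to the same point and have the same image under `f`.
  refine hf.faithful (g.toFun x) _ _ ?_ ?_
  · rw [mul_smul, ← g.map_smul, ha, mul_smul, ha, g'.map_smul]
  · rw [f.act_mul, f.act_mul, ← g.map_smul, ha', ha', ha, h]

theorem IsFF.whiskerRight_injective {f : B ⟶ C} (hf : IsFF f) {g g' : A ⟶ B} {ζ ζ' : g ⟶ g'}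
    (h : ζ ▷ f = ζ' ▷ f) : ζ = ζ' :=
  cell_ext fun x => hf.faithful (g.toFun x) _ _ ((ζ.app_smul x).symm.trans (ζ'.app_smul x))
    (congrArg (fun e => Cell.app e x) h)

/-- An equivalence has a quasi-inverse. -/
theorem IsEqv.exists_inverse {f : A ⟶ B} (hf : IsEqv f) :
    ∃ g : B ⟶ A, Nonempty (g ≫ f ⟶ 𝟙 B) := by
  -- `f` is a 1-cell from the span with both legs `f` to the identity span, so its inverse is read
  -- off from an adjoint equivalence of spans.
  obtain ⟨e⟩ := Span.adjEquiv_of_isEqv (S := (⟨A, f, f⟩ : Span B B)) (T := Span.idSpan B)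
    ⟨f, 𝟙 f, 𝟙 f⟩ hf
  exact ⟨Span.Hom.φ e.inv, ⟨Span.Hom.μl e.inv⟩⟩

/-- The 2-fibered product of two identities is `B` itself, and an equivalence to `B` provides
another model of it. Through the Mackey condition this makes transfer along `f` a left inverse of
composition with restriction: restricting and then transferring along an equivalence is the
identity. -/
theorem IsEqv.isTwoPullback_id {f : A ⟶ B} (hf : IsEqv f) :
    IsTwoPullback f f (𝟙 B) (𝟙 B) (𝟙 (f ≫ 𝟙 B)) where
  exists_lift {X} g₁ g₂ ϵ := by
    obtain ⟨q, ⟨η⟩⟩ := hf.exists_inverse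
    let ϵ' : g₁ ⟶ g₂ := ϵ
    let ξ : (g₂ ≫ q) ≫ f ⟶ g₂ := g₂ ◁ η
    -- The lift is a preimage of `g₂` under the equivalence; `ϵ` then corrects the comparison with
    -- `g₁`.
    refine ⟨g₂ ≫ q, ξ ≫ (cellIso ϵ').inv, ξ, cell_ext fun x => ?_⟩
    change ϵ.app x * ((ϵ.app x)⁻¹ * ξ.app x) = ξ.app x * 1 * 1 * 1
    group
  existsUnique_cell {X g₁ g₂} ϵ {g g'} ξ₁ ξ₂ ξ₁' ξ₂' h h' := by
    obtain ⟨ζ, hζ⟩ := hf.toIsFF.exists_whiskerRight_eq (ξ₁ ≫ (cellIso ξ₁').inv)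
    have h₁ : ζ ▷ f ≫ ξ₁' = ξ₁ := (cellIso ξ₁').eq_comp_inv.mp hζ
    refine ⟨ζ, ⟨h₁, cell_ext fun x => ?_⟩, fun ζ' hζ' => ?_⟩
    · have k : ϵ.app x * ξ₁.app x = ξ₂.app x * 1 * 1 * 1 := congrArg (fun e => Cell.app e x) h
      have k' : ϵ.app x * ξ₁'.app x = ξ₂'.app x * 1 * 1 * 1 :=
        congrArg (fun e => Cell.app e x) h'
      have k₁ : ξ₁'.app x * (ζ ▷ f).app x = ξ₁.app x := congrArg (fun e => Cell.app e x) h₁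
      change ξ₂'.app x * (ζ ▷ f).app x = ξ₂.app x
      simp only [mul_one] at k k'
      rw [← k, ← k', mul_assoc, k₁]
    · refine hf.toIsFF.whiskerRight_injective (hζ.symm ▸ ?_)
      exact (cellIso ξ₁').eq_comp_inv.mpr hζ'.1

/-- A fully faithful 1-cell behaves like a monomorphism: a 2-cell between two 1-cells into `B` that
factor through `f` already comes from `A`, so the self-intersection of `f` is `A`. -/
theorem IsFF.isTwoPullback {f : A ⟶ B} (hf : IsFF f) :
    IsTwoPullback (𝟙 A) (𝟙 A) f f (𝟙 (𝟙 A ≫ f)) where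
  exists_lift {X} g₁ g₂ ϵ := by
    obtain ⟨ζ, hζ⟩ := hf.exists_whiskerRight_eq ϵ
    refine ⟨g₁, 𝟙 g₁, ζ, cell_ext fun x => ?_⟩
    have k : (ζ ▷ f).app x = ϵ.app x := congrArg (fun e => Cell.app e x) hζ
    change ϵ.app x * f.act _ 1 = (ζ ▷ f).app x * 1 * 1 * 1
    simp only [k, Hom.act_one, mul_one]
  existsUnique_cell {X g₁ g₂} ϵ {g g'} ξ₁ ξ₂ ξ₁' ξ₂' h h' := by
    let ζ : g ⟶ g' := ξ₁ ≫ (cellIso ξ₁').inv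
    have h₁ : ζ ≫ ξ₁' = ξ₁ := (cellIso ξ₁').eq_comp_inv.mp rfl
    -- Once `ϵ` is lifted to `A`, each compatible pair has its second 2-cell determined by the
    -- first, so a single 2-cell `ζ` serves both projections.
    obtain ⟨ϵ', rfl⟩ := hf.exists_whiskerRight_eq ϵ
    have k : ξ₁ ≫ ϵ' = ξ₂ := hf.whiskerRight_injective (by
      rw [comp_whiskerRight]
      refine h.trans (cell_ext fun x => ?_)
      change f.act _ (ξ₂.app x) * 1 * 1 * 1 = f.act _ (ξ₂.app x)
      simp only [mul_one])
    have k' : ξ₁' ≫ ϵ' = ξ₂' := hf.whiskerRight_injective (by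
      rw [comp_whiskerRight]
      refine h'.trans (cell_ext fun x => ?_)
      change f.act _ (ξ₂'.app x) * 1 * 1 * 1 = f.act _ (ξ₂'.app x)
      simp only [mul_one])
    refine ⟨ζ, ⟨h₁, ?_⟩, fun ζ' hζ' => ?_⟩
    · rw [← k, ← k']
      exact (Category.assoc ζ ξ₁' ϵ').symm.trans (congrArg (· ≫ ϵ') h₁)
    · exact (cellIso ξ₁').eq_comp_inv.mpr hζ'.1

/-- An endomorphism of a 2-fibered product over its legs is isomorphic to the identity. -/
theorem IsTwoPullback.exists_cell_id {π₁ : P ⟶ A} {π₂ : P ⟶ B} {f₁ : A ⟶ C} {f₂ : B ⟶ C}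
    {κ : π₁ ≫ f₁ ⟶ π₂ ≫ f₂} (h : IsTwoPullback π₁ π₂ f₁ f₂ κ) {k : P ⟶ P} (ξ₁ : k ≫ π₁ ⟶ π₁)
    (ξ₂ : k ≫ π₂ ⟶ π₂)
    (e : ∀ x, κ.app x * f₁.act (π₁.toFun (k.toFun x)) (ξ₁.app x) =
      f₂.act (π₂.toFun (k.toFun x)) (ξ₂.app x) * κ.app (k.toFun x)) :
    Nonempty (k ⟶ 𝟙 P) := by
  -- `k` and `𝟙 P` are two lifts of the same cone, the one formed by the legs and `κ`.
  obtain ⟨ζ, -, -⟩ := h.existsUnique_cell (X := P) κ ξ₁ ξ₂ (g' := 𝟙 P) (λ_ π₁).hom (λ_ π₂).hom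
    (cell_ext fun x => (e x).trans (by
      change _ = _ * 1 * κ.app (k.toFun x) * 1
      simp only [mul_one]; rfl))
    (cell_ext fun x => by
      change κ.app x * f₁.act _ 1 = f₂.act _ 1 * 1 * κ.app x * 1
      simp only [Hom.act_one, mul_one, one_mul])
  exact ⟨ζ⟩

/-- Two 2-fibered products of the same 1-cells are adjoint equivalent spans. -/
theorem IsTwoPullback.adjEquiv {π₁ : P ⟶ A} {π₂ : P ⟶ B} {f₁ : A ⟶ C} {f₂ : B ⟶ C}
    {κ : π₁ ≫ f₁ ⟶ π₂ ≫ f₂} (h : IsTwoPullback π₁ π₂ f₁ f₂ κ) {π₁' : Q ⟶ A} {π₂' : Q ⟶ B}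
    {κ' : π₁' ≫ f₁ ⟶ π₂' ≫ f₂} (h' : IsTwoPullback π₁' π₂' f₁ f₂ κ') :
    Span.AdjEquiv ⟨P, π₁, π₂⟩ ⟨Q, π₁', π₂'⟩ := by
  -- Pasting the compatibilities of two comparison 1-cells shows that their composite is an
  -- endomorphism over the legs and over `κ`. Stated for arbitrary `P` and `Q` so that it applies to
  -- both composites.
  have key : ∀ {P Q : GrSet.{u}} {π₁ : P ⟶ A} {π₂ : P ⟶ B} {κ : π₁ ≫ f₁ ⟶ π₂ ≫ f₂}
      {π₁' : Q ⟶ A} {π₂' : Q ⟶ B} {κ' : π₁' ≫ f₁ ⟶ π₂' ≫ f₂}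
      (_ : IsTwoPullback π₁ π₂ f₁ f₂ κ) (g : P ⟶ Q) (ξ₁ : g ≫ π₁' ⟶ π₁) (ξ₂ : g ≫ π₂' ⟶ π₂)
      (g' : Q ⟶ P) (ξ₁' : g' ≫ π₁ ⟶ π₁') (ξ₂' : g' ≫ π₂ ⟶ π₂'),
      (∀ x, κ.app x * f₁.act (π₁'.toFun (g.toFun x)) (ξ₁.app x) =
        f₂.act (π₂'.toFun (g.toFun x)) (ξ₂.app x) * κ'.app (g.toFun x)) →
      (∀ x, κ'.app x * f₁.act (π₁.toFun (g'.toFun x)) (ξ₁'.app x) =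
        f₂.act (π₂.toFun (g'.toFun x)) (ξ₂'.app x) * κ.app (g'.toFun x)) →
      Nonempty (g ≫ g' ⟶ 𝟙 P) := by
    intro P Q π₁ π₂ κ π₁' π₂' κ' h g ξ₁ ξ₂ g' ξ₁' ξ₂' e e'
    refine h.exists_cell_id (k := g ≫ g') (g ◁ ξ₁' ≫ ξ₁ : g ≫ (g' ≫ π₁) ⟶ π₁)
      (g ◁ ξ₂' ≫ ξ₂ : g ≫ (g' ≫ π₂) ⟶ π₂) fun x => ?_
    have a₁ := f₁.act_mul (((g ≫ g') ≫ π₁).toFun x) (ξ₁.app x) (ξ₁'.app (g.toFun x))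
    have a₂ := f₂.act_mul (((g ≫ g') ≫ π₂).toFun x) (ξ₂.app x) (ξ₂'.app (g.toFun x))
    have b₁ := ξ₁'.app_smul (g.toFun x)
    have b₂ := ξ₂'.app_smul (g.toFun x)
    simp only [comp_toFun] at a₁ a₂ b₁ b₂
    rw [← b₁] at a₁
    rw [← b₂] at a₂
    have e₁ := e x
    have e₂ := e' (g.toFun x)
    refine (congrArg (κ.app x * ·) a₁).trans (Eq.trans ?_ (congrArg (· * _) a₂.symm))
    rw [← mul_assoc, e₁, mul_assoc, e₂, mul_assoc]
    rfl
  have eqn : ∀ {P Q : GrSet.{u}} {π₁ : P ⟶ A} {π₂ : P ⟶ B} {κ : π₁ ≫ f₁ ⟶ π₂ ≫ f₂}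
      {π₁' : Q ⟶ A} {π₂' : Q ⟶ B} {κ' : π₁' ≫ f₁ ⟶ π₂' ≫ f₂}
      (_ : IsTwoPullback π₁' π₂' f₁ f₂ κ'), ∃ (g : P ⟶ Q) (ξ₁ : g ≫ π₁' ⟶ π₁)
      (ξ₂ : g ≫ π₂' ⟶ π₂),
      ∀ x, κ.app x * f₁.act (π₁'.toFun (g.toFun x)) (ξ₁.app x) =
        f₂.act (π₂'.toFun (g.toFun x)) (ξ₂.app x) * κ'.app (g.toFun x) := by
    intro P Q π₁ π₂ κ π₁' π₂' κ' h
    obtain ⟨g, ξ₁, ξ₂, e⟩ := h.exists_lift π₁ π₂ κ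
    refine ⟨g, ξ₁, ξ₂, fun x => (congrArg (fun t => Cell.app t x) e).trans ?_⟩
    change f₂.act _ (ξ₂.app x) * 1 * κ'.app (g.toFun x) * 1 = _
    simp only [mul_one]
    rfl
  obtain ⟨g, ξ₁, ξ₂, e⟩ := eqn (κ := κ) h'
  obtain ⟨g', ξ₁', ξ₂', e'⟩ := eqn (κ := κ') h
  obtain ⟨s⟩ := key h g ξ₁ ξ₂ g' ξ₁' ξ₂' e e'
  obtain ⟨t⟩ := key h' g' ξ₁' ξ₂' g ξ₁ ξ₂ e' e
  exact Span.adjEquiv_of_isEqv ⟨g, ξ₁, ξ₂⟩ (isEqv_of_cells (cellIso s).inv t)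

/-- Every 2-coproduct is equivalent to the standard one. -/
theorem IsTwoCoproduct.exists_isEqv {i : A ⟶ P} {j : B ⟶ P} (h : IsTwoCoproduct i j) :
    ∃ f : coprod A B ⟶ P, IsEqv f ∧ Nonempty (coprod.inl A B ≫ f ⟶ i) ∧
      Nonempty (coprod.inr A B ≫ f ⟶ j) := by
  have h₀ := coprod.isTwoCoproduct A B
  obtain ⟨f, ⟨s⟩, ⟨t⟩⟩ := h₀.exists_desc i j
  obtain ⟨g, ⟨s'⟩, ⟨t'⟩⟩ := h.exists_desc (coprod.inl A B) (coprod.inr A B)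
  -- The composite of two comparisons and the identity restrict compatibly to both summands, so the
  -- 2-coproduct property gives a 2-cell between them.
  have key : ∀ {P Q : GrSet.{u}} {i : A ⟶ P} {j : B ⟶ P} {i' : A ⟶ Q} {j' : B ⟶ Q}
      (_ : IsTwoCoproduct i j) (f : P ⟶ Q) (g : Q ⟶ P) (_ : i ≫ f ⟶ i') (_ : j ≫ f ⟶ j')
      (_ : i' ≫ g ⟶ i) (_ : j' ≫ g ⟶ j), Nonempty (f ≫ g ⟶ 𝟙 P) := by
    intro P Q i j i' j' h f g s t s' t'
    obtain ⟨η, -, -⟩ := h.existsUnique_cell (f := f ≫ g) (f' := 𝟙 P)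
      (s ▷ g ≫ s' : (i ≫ f) ≫ g ⟶ i) (t ▷ g ≫ t' : (j ≫ f) ≫ g ⟶ j) (ρ_ i).hom (ρ_ j).hom
    exact ⟨η⟩
  obtain ⟨a⟩ := key h₀ f g s t s' t'
  obtain ⟨b⟩ := key h g f s' t' s t
  exact ⟨f, isEqv_of_cells (cellIso a).inv b, ⟨s⟩, ⟨t⟩⟩

end GrSet

/-! ### Binary products and their preservation. -/

section Products

variable {C : Type c} [Category.{v2} C] {D : Type d} [Category.{v} D]

/-- `A ⟵ P ⟶ B` is a product diagram. -/
def IsProd {A B P : C} (p : P ⟶ A) (q : P ⟶ B) : Prop :=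
  ∀ ⦃X : C⦄ (f : X ⟶ A) (g : X ⟶ B), ∃! h : X ⟶ P, h ≫ p = f ∧ h ≫ q = g

theorem isProd_iff_nonempty_isLimit {A B P : C} {p : P ⟶ A} {q : P ⟶ B} :
    IsProd p q ↔ Nonempty (IsLimit (BinaryFan.mk p q)) := by
  refine ⟨fun h => ?_, fun ⟨h⟩ X f g => ?_⟩
  · choose l hl hl' using fun X (f : X ⟶ A) (g : X ⟶ B) => h f g
    exact ⟨BinaryFan.isLimitMk (fun s => l _ s.fst s.snd) (fun s => (hl _ _ _).1)
      (fun s => (hl _ _ _).2) (fun s m h₁ h₂ => hl' _ _ _ m ⟨h₁, h₂⟩)⟩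
  · obtain ⟨l, h₁, h₂⟩ := BinaryFan.IsLimit.lift' h f g
    exact ⟨l, ⟨h₁, h₂⟩, fun l' hl' => BinaryFan.IsLimit.hom_ext h (hl'.1.trans h₁.symm)
      (hl'.2.trans h₂.symm)⟩

theorem IsProd.hom_ext {A B P : C} {p : P ⟶ A} {q : P ⟶ B} (h : IsProd p q) {X : C}
    {f g : X ⟶ P} (hp : f ≫ p = g ≫ p) (hq : f ≫ q = g ≫ q) : f = g :=
  (h (g ≫ p) (g ≫ q)).unique ⟨hp, hq⟩ ⟨rfl, rfl⟩

theorem isIso_prod_lift_iff {A B P : C} [HasBinaryProduct A B] {p : P ⟶ A} {q : P ⟶ B} :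
    IsIso (prod.lift p q) ↔ IsProd p q := by
  refine ⟨fun _ X f g => ?_, fun h => ?_⟩
  · refine ⟨prod.lift f g ≫ inv (prod.lift p q), ⟨?_, ?_⟩, fun k hk => ?_⟩
    · rw [Category.assoc, (IsIso.inv_comp_eq _).mpr (prod.lift_fst p q).symm, prod.lift_fst]
    · rw [Category.assoc, (IsIso.inv_comp_eq _).mpr (prod.lift_snd p q).symm, prod.lift_snd]
    · rw [IsIso.eq_comp_inv, prod.comp_lift, hk.1, hk.2]
  · obtain ⟨l, ⟨h₁, h₂⟩, -⟩ := h (prod.fst : A ⨯ B ⟶ A) prod.snd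
    refine ⟨l, h.hom_ext ?_ ?_, ?_⟩
    · rw [Category.assoc, h₁, prod.lift_fst, Category.id_comp]
    · rw [Category.assoc, h₂, prod.lift_snd, Category.id_comp]
    · rw [prod.comp_lift, h₁, h₂, prod.lift_fst_snd]

theorem IsProd.map {A B P : C} {p : P ⟶ A} {q : P ⟶ B} (h : IsProd p q) (F : C ⥤ D)
    [PreservesFiniteProducts F] : IsProd (F.map p) (F.map q) := by
  obtain ⟨h⟩ := isProd_iff_nonempty_isLimit.mp h
  exact isProd_iff_nonempty_isLimit.mpr ⟨mapIsLimitOfPreservesOfIsLimit F p q h⟩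

/-- A functor preserves finite products if it preserves a terminal object and a product of any two
objects. -/
theorem preservesFiniteProducts_of_isProd (F : C ⥤ D) {t : C} (ht : IsTerminal t)
    (ht' : IsTerminal (F.obj t))
    (H : ∀ A B : C, ∃ (P : C) (p : P ⟶ A) (q : P ⟶ B),
      IsProd p q ∧ IsProd (F.map p) (F.map q)) : PreservesFiniteProducts F := by
  -- The diagrams supplied by `H` give both the existence of binary products in `C` and their
  -- preservation by `F`.
  have hb : ∀ A B : C, HasLimit (pair A B) ∧ PreservesLimit (pair A B) F := fun A B => by
    obtain ⟨P, p, q, h, h'⟩ := H A B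
    obtain ⟨h⟩ := isProd_iff_nonempty_isLimit.mp h
    obtain ⟨h'⟩ := isProd_iff_nonempty_isLimit.mp h'
    exact ⟨⟨⟨_, h⟩⟩, preservesLimit_of_preserves_limit_cone h
      ((isLimitMapConeBinaryFanEquiv F p q).symm h')⟩
  have : HasTerminal C := ht.hasTerminal
  have : HasBinaryProducts C := by
    have : ∀ {A B : C}, HasLimit (pair A B) := fun {A B} => (hb A B).1
    exact hasBinaryProducts_of_hasLimit_pair C
  have : HasFiniteProducts C := hasFiniteProducts_of_has_binary_and_terminal
  have : PreservesLimitsOfShape (Discrete WalkingPair) F :=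
    ⟨fun {K} => by
      have := (hb (K.obj ⟨.left⟩) (K.obj ⟨.right⟩)).2
      exact preservesLimit_of_iso_diagram F (diagramIsoPair K).symm⟩
  have : PreservesLimit (Functor.empty.{0} C) F :=
    preservesLimit_of_preserves_limit_cone ht
      ((isLimitMapConeEmptyConeEquiv F t).symm ht')
  have : PreservesLimitsOfShape (Discrete PEmpty.{1}) F :=
    preservesLimitsOfShape_pempty_of_preservesTerminal F
  exact PreservesFiniteProducts.of_preserves_binary_and_terminal F

end Products

/-! ### Generators, relations and biproducts of the span category. -/

namespace Sp

variable {A B C P W : GrSet.{u}}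

/-- The covariant morphism of the span category given by a 1-cell. -/
def tr (f : A ⟶ B) : (⟨A⟩ : Sp.{u}) ⟶ ⟨B⟩ := ofSpan ⟨A, f, 𝟙 A⟩

/-- The contravariant morphism of the span category given by a 1-cell. -/
def res (f : A ⟶ B) : (⟨B⟩ : Sp.{u}) ⟶ ⟨A⟩ := ofSpan ⟨A, 𝟙 A, f⟩

/-- Definitional, because `𝕊` is strict: the identity outer legs disappear on the nose. -/
theorem tr_comp_res (f : A ⟶ C) (g : B ⟶ C) :
    tr f ≫ res g = ofSpan ⟨comma g f, comma.fst g f, comma.snd g f⟩ := rfl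

/-- The middle of the composite is the 2-fibered product of two identities. Its second projection is
an equivalence to `W`, and the canonical 2-cell absorbs the difference with the first projection in
the leg `g`. -/
theorem res_comp_tr (f : W ⟶ A) (g : W ⟶ B) : res f ≫ tr g = ofSpan ⟨W, g, f⟩ :=
  ofSpan_eq_iff.mpr (Span.adjEquiv_of_isEqv
    ⟨comma.snd (𝟙 W) (𝟙 W), Cell.whiskerRight (cellIso (comma.cell (𝟙 W) (𝟙 W))).inv g, 𝟙 _⟩
    (comma_snd_isEqv (𝟙 W)))

theorem res_comp_tr_span (S : Span B A) : res S.r ≫ tr S.l = ofSpan S := res_comp_tr S.r S.l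

theorem tr_comp (f : A ⟶ B) (g : B ⟶ C) : tr (f ≫ g) = tr f ≫ tr g :=
  (ofSpan_eq_iff.mpr (Span.adjEquiv_of_isEqv
    ⟨comma.snd (𝟙 B) f, Cell.whiskerRight (cellIso (comma.cell (𝟙 B) f)).inv g, 𝟙 _⟩
    (comma_snd_isEqv f))).symm

theorem res_comp (f : A ⟶ B) (g : B ⟶ C) : res (f ≫ g) = res g ≫ res f :=
  (ofSpan_eq_iff.mpr (Span.adjEquiv_of_isEqv
    ⟨comma.fst f (𝟙 B), 𝟙 _, Cell.whiskerRight (comma.cell f (𝟙 B)) g⟩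
    (comma_fst_isEqv f))).symm

theorem tr_cell {f f' : A ⟶ B} (η : f ⟶ f') : tr f = tr f' :=
  ofSpan_eq_iff.mpr (Span.adjEquiv_of_isEqv ⟨𝟙 A, (cellIso η).inv, 𝟙 _⟩ (IsEqv.id A))

theorem res_cell {f f' : A ⟶ B} (η : f ⟶ f') : res f = res f' :=
  ofSpan_eq_iff.mpr (Span.adjEquiv_of_isEqv ⟨𝟙 A, 𝟙 _, (cellIso η).inv⟩ (IsEqv.id A))

@[simp] theorem tr_id (A : GrSet.{u}) : tr (𝟙 A) = 𝟙 _ := rfl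

@[simp] theorem res_id (A : GrSet.{u}) : res (𝟙 A) = 𝟙 _ := rfl

/-- The left side is computed by the standard 2-fibered product and the right side is the span of
the given one; the two are adjoint equivalent. -/
theorem mackey {γ : W ⟶ A} {δ : W ⟶ B} {α : A ⟶ C} {β : B ⟶ C} {κ : γ ≫ α ⟶ δ ≫ β}
    (h : IsTwoPullback γ δ α β κ) : tr β ≫ res α = res δ ≫ tr γ := by
  rw [tr_comp_res, res_comp_tr]
  exact ofSpan_eq_iff.mpr ((comma.isTwoPullback α β).adjEquiv h)

theorem tr_comp_res_of_isFF {f : A ⟶ B} (hf : IsFF f) : tr f ≫ res f = 𝟙 _ := by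
  rw [mackey hf.isTwoPullback]
  exact Category.id_comp _

theorem res_comp_tr_of_isEqv {f : A ⟶ B} (hf : IsEqv f) : res f ≫ tr f = 𝟙 _ := by
  -- The identity is rewritten as `tr (𝟙 B) ≫ res (𝟙 B)`, one side of a Mackey square.
  rw [← tr_id, ← Category.comp_id (tr (𝟙 B)), ← res_id B, mackey hf.isTwoPullback_id]

/-- A point of the 2-fibered product would carry a group element relating the two images, so the
middle of the composite span is empty. -/
theorem tr_comp_res_of_disjoint {f : A ⟶ C} {g : B ⟶ C}
    (h : ∀ x y (k : C.G), k • g.toFun x ≠ f.toFun y) : tr f ≫ res g = 0 := by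
  rw [tr_comp_res, ← ofSpan_zero]
  exact (ofSpan_eq_iff.mpr (Span.adjEquiv_zero _
    ⟨fun p => h (CommaX.fst p) (CommaX.snd p) (CommaX.arr p) (CommaX.eq p).symm⟩)).symm

/-- The equations of a biproduct. -/
structure IsBiprod (i : A ⟶ P) (j : B ⟶ P) : Prop where
  inl_fst : tr i ≫ res i = 𝟙 _
  inr_snd : tr j ≫ res j = 𝟙 _
  inl_snd : tr i ≫ res j = 0
  inr_fst : tr j ≫ res i = 0
  total : res i ≫ tr i + res j ≫ tr j = 𝟙 _

theorem isBiprod_coprod (A B : GrSet.{u}) : IsBiprod (coprod.inl A B) (coprod.inr A B) where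
  inl_fst := tr_comp_res_of_isFF (coprod.inl_isFF A B)
  inr_snd := tr_comp_res_of_isFF (coprod.inr_isFF A B)
  inl_snd := tr_comp_res_of_disjoint fun x y ⟨g, k⟩ e =>
    coprod.mkl_ne_mkr _ _ _ _ (e.symm.trans (coprod.smul_mkr g k 1 x))
  inr_fst := tr_comp_res_of_disjoint fun x y ⟨g, k⟩ e =>
    coprod.mkl_ne_mkr _ _ _ _ ((coprod.smul_mkl g k x 1).symm.trans e)
  total := by
    -- The condition of being a sum concerns only the underlying 1-cells, so the disjoint cover of
    -- the coproduct by its two coprojections can be reused with the identity span as target.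
    have h := Span.isSum_sum (⟨A, coprod.inl A B, coprod.inl A B⟩ : Span _ _)
      ⟨B, coprod.inr A B, coprod.inr A B⟩
    rw [res_comp_tr, res_comp_tr, ← ofSpan_sum, ← ofSpan_id, ofSpan_eq_iff]
    exact Span.IsSum.adjEquiv (P := Span.idSpan (coprod A B)) (i := ⟨coprod.inl A B, 𝟙 _, 𝟙 _⟩)
      (j := ⟨coprod.inr A B, 𝟙 _, 𝟙 _⟩) ⟨h.left, h.right, h.disj, h.cover⟩

/-- A 2-coproduct differs from the standard one by an equivalence `f`, and `tr f`, `res f` are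
mutually inverse in `Sp`, so the equations are transported by conjugation. -/
theorem isBiprod {i : A ⟶ P} {j : B ⟶ P} (h : IsTwoCoproduct i j) : IsBiprod i j := by
  obtain ⟨f, hf, ⟨s⟩, ⟨t⟩⟩ := h.exists_isEqv
  have b := isBiprod_coprod A B
  have e {X : Sp.{u}} (k : _ ⟶ X) : tr f ≫ res f ≫ k = k := by
    rw [← Category.assoc, tr_comp_res_of_isFF hf.toIsFF, Category.id_comp]
  have ti : tr i = tr (coprod.inl A B) ≫ tr f := (tr_cell s).symm.trans (tr_comp _ _)
  have tj : tr j = tr (coprod.inr A B) ≫ tr f := (tr_cell t).symm.trans (tr_comp _ _)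
  have ri : res i = res f ≫ res (coprod.inl A B) := (res_cell s).symm.trans (res_comp _ _)
  have rj : res j = res f ≫ res (coprod.inr A B) := (res_cell t).symm.trans (res_comp _ _)
  refine ⟨?_, ?_, ?_, ?_, ?_⟩ <;> simp only [ti, tj, ri, rj, Category.assoc, e]
  · exact b.inl_fst
  · exact b.inr_snd
  · exact b.inl_snd
  · exact b.inr_fst
  · rw [← comp_add, ← Category.assoc (res (coprod.inl A B)), ← Category.assoc (res (coprod.inr A B)),
      ← add_comp, b.total, Category.id_comp, res_comp_tr_of_isEqv hf]

/-- The usual argument for biproducts; it needs only biadditive composition and no negatives, so it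
works in `Sp`. -/
theorem IsBiprod.isProd {i : A ⟶ P} {j : B ⟶ P} (h : IsBiprod i j) : IsProd (res i) (res j) := by
  intro X f g
  refine ⟨f ≫ tr i + g ≫ tr j, ⟨?_, ?_⟩, fun k hk => ?_⟩
  · rw [add_comp, Category.assoc, Category.assoc, h.inl_fst, h.inr_fst, comp_zero, add_zero,
      Category.comp_id]
  · rw [add_comp, Category.assoc, Category.assoc, h.inl_snd, h.inr_snd, comp_zero, zero_add,
      Category.comp_id]
  · rw [← hk.1, ← hk.2, Category.assoc, Category.assoc, ← comp_add, h.total, Category.comp_id]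

theorem id_eq_zero (h : IsEmpty A.X) : 𝟙 (⟨A⟩ : Sp.{u}) = 0 :=
  (ofSpan_eq_iff.mpr (Span.adjEquiv_zero (Span.idSpan A) h)).symm

theorem nonempty_isTerminal (h : IsEmpty A.X) : Nonempty (IsTerminal (⟨A⟩ : Sp.{u})) :=
  ⟨IsTerminal.ofUniqueHom (fun _ => 0) fun X m => by
    rw [← Category.comp_id m, id_eq_zero h, comp_zero]⟩

/-- A functor on the span category preserves finite products if it sends the standard biproduct
diagrams to products and the empty 0-cell to a terminal object. -/
theorem preservesFiniteProducts {D : Type d} [Category.{v} D] (F : Sp.{u} ⥤ D)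
    (h₀ : Nonempty (IsTerminal (F.obj ⟨empty⟩)))
    (h : ∀ A B : GrSet.{u},
      IsProd (F.map (res (coprod.inl A B))) (F.map (res (coprod.inr A B)))) :
    PreservesFiniteProducts F :=
  preservesFiniteProducts_of_isProd F (nonempty_isTerminal inferInstance).some h₀.some
    fun A B => ⟨_, _, _, (isBiprod_coprod A.as B.as).isProd, h A.as B.as⟩

end Sp

/-! ### Additivity of `𝒯` and finite products in it. -/

namespace Tcal

variable {A B C P : GrSet.{u}}

noncomputable instance : Preadditive Tcal.{u} where
  homGroup A B := inferInstanceAs (AddCommGroup (Hom A B))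
  add_comp A B C f f' g :=
    DFunLike.congr_fun ((compHom A.as B.as C.as).map_add f f') g
  comp_add A B C f g g' := (compHom A.as B.as C.as f).map_add g g'

theorem c_map_add {A B : Sp.{u}} (s t : A ⟶ B) : c.map (s + t) = c.map s + c.map t :=
  map_add of s t

theorem c_map_zero (A B : Sp.{u}) : c.map (0 : A ⟶ B) = 0 :=
  map_zero of

theorem exists_eq_c_map_sub {A B : Sp.{u}} (x : c.obj A ⟶ c.obj B) :
    ∃ s t : A ⟶ B, x = c.map s - c.map t :=
  exists_eq_sub x

/-- The biproduct equations are sums and composites of spans, both of which `c` preserves. -/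
theorem isProd {i : A ⟶ P} {j : B ⟶ P} (h : Sp.IsBiprod i j) :
    IsProd (c.map (Sp.res i)) (c.map (Sp.res j)) := by
  have e₁ := (c.map_comp _ _).symm.trans (congrArg c.map h.inl_fst)
  have e₂ := (c.map_comp _ _).symm.trans (congrArg c.map h.inr_snd)
  have e₃ := (c.map_comp _ _).symm.trans (congrArg c.map h.inl_snd)
  have e₄ := (c.map_comp _ _).symm.trans (congrArg c.map h.inr_fst)
  have e₅ := congrArg c.map h.total
  rw [c_map_add, c.map_comp, c.map_comp, c.map_id] at e₅
  rw [c.map_id] at e₁ e₂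
  rw [c_map_zero] at e₃ e₄
  intro X f g
  refine ⟨f ≫ c.map (Sp.tr i) + g ≫ c.map (Sp.tr j), ⟨?_, ?_⟩, fun k hk => ?_⟩
  · rw [Preadditive.add_comp, Category.assoc, Category.assoc, e₁, e₄, comp_zero, add_zero,
      Category.comp_id]
  · rw [Preadditive.add_comp, Category.assoc, Category.assoc, e₂, e₃, comp_zero, zero_add,
      Category.comp_id]
  · rw [← hk.1, ← hk.2, Category.assoc, Category.assoc, ← Preadditive.comp_add, e₅,
      Category.comp_id]

theorem nonempty_isTerminal (h : IsEmpty A.X) : Nonempty (IsTerminal (⟨A⟩ : Tcal.{u})) := by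
  have e : 𝟙 (⟨A⟩ : Tcal.{u}) = 0 := (congrArg c.map (Sp.id_eq_zero h)).trans (c_map_zero _ _)
  exact ⟨IsTerminal.ofUniqueHom (fun _ => 0) fun X m => by
    rw [← Category.comp_id m, e, comp_zero]⟩

/-- A functor on `𝒯` preserves finite products if its restriction to the span category does. -/
theorem preservesFiniteProducts {D : Type d} [Category.{v} D] (G : Tcal.{u} ⥤ D)
    [PreservesFiniteProducts (c ⋙ G)] : PreservesFiniteProducts G :=
  preservesFiniteProducts_of_isProd G (nonempty_isTerminal inferInstance).some
    ((Sp.nonempty_isTerminal inferInstance).some.isTerminalObj (c ⋙ G) ⟨empty⟩)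
    fun A B => ⟨_, _, _, isProd (Sp.isBiprod_coprod A.as B.as),
      (Sp.isBiprod_coprod A.as B.as).isProd.map (c ⋙ G)⟩

instance : PreservesFiniteProducts c.{u} :=
  Sp.preservesFiniteProducts c (nonempty_isTerminal inferInstance)
    fun A B => isProd (Sp.isBiprod_coprod A B)

end Tcal

/-! ### Semi-Mackey functors as product-preserving functors on spans. -/

namespace SemiMackey

variable {D : Type d} [Category.{v} D] [HasFiniteProducts D]

theorem res_comp_tr_of_isEqv (M : SemiMackey.{u} D) {A B : GrSet.{u}} {f : A ⟶ B} (hf : IsEqv f) :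
    M.res f ≫ M.tr f = 𝟙 _ := by
  rw [← M.mackey f f (𝟙 B) (𝟙 B) _ hf.isTwoPullback_id, M.tr_id, M.res_id, Category.comp_id]

/-- The morphism `M_*(α_S) ∘ M^*(β_S)` given by a span `S`. -/
def spanMap (M : SemiMackey.{u} D) {X Y : GrSet.{u}} (S : Span Y X) : M.obj X ⟶ M.obj Y :=
  M.res S.r ≫ M.tr S.l

/-- An adjoint equivalence `φ` of spans lets both legs of `S` factor, up to 2-cells, through those
of `T`; the inner factor, restriction and then transfer along `φ`, is the identity. -/
theorem spanMap_congr (M : SemiMackey.{u} D) {X Y : GrSet.{u}} {S T : Span Y X}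
    (h : S.AdjEquiv T) : M.spanMap S = M.spanMap T := by
  obtain ⟨f, hf⟩ := h.exists_isEqv
  have e₁ : M.res S.r = M.res T.r ≫ M.res (Span.Hom.φ f) :=
    (M.res_cell (Span.Hom.μr f)).symm.trans (M.res_comp _ _)
  have e₂ : M.tr S.l = M.tr (Span.Hom.φ f) ≫ M.tr T.l :=
    (M.tr_cell (Span.Hom.μl f)).symm.trans (M.tr_comp _ _)
  rw [spanMap, spanMap, e₁, e₂, Category.assoc, ← Category.assoc (M.res _) (M.tr _),
    M.res_comp_tr_of_isEqv hf, Category.id_comp]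

/-- The Mackey condition interchanges the two inner arrows, the transfer of one span and the
restriction of the other. -/
theorem spanMap_comp (M : SemiMackey.{u} D) {X Y Z : GrSet.{u}} (T : Span Z Y) (S : Span Y X) :
    M.spanMap (T.comp S) = M.spanMap S ≫ M.spanMap T := by
  have h := M.mackey _ _ _ _ _ (comma.isTwoPullback T.r S.l)
  rw [spanMap, spanMap, spanMap, Category.assoc, ← Category.assoc (M.tr S.l), h]
  refine (congrArg₂ (· ≫ ·) (M.res_comp _ _) (M.tr_comp _ _)).trans ?_
  simp only [Category.assoc]
  rfl

/-- The functor on the span category given by a semi-Mackey functor. -/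
def spanFunctor (M : SemiMackey.{u} D) : Sp.{u} ⥤ D where
  obj A := M.obj A.as
  map {A B} f := Quotient.lift (s := Span.setoid B.as A.as) M.spanMap
    (fun _ _ h => M.spanMap_congr h) f
  map_id A := by
    change M.res (𝟙 A.as) ≫ M.tr (𝟙 A.as) = _
    rw [M.res_id, M.tr_id, Category.comp_id]
  map_comp f g := by
    obtain ⟨S, rfl⟩ := Sp.Hom.exists_rep f
    obtain ⟨T, rfl⟩ := Sp.Hom.exists_rep g
    exact M.spanMap_comp T S

variable (M N : SemiMackey.{u} D)

@[simp] theorem spanFunctor_map_res {X Y : GrSet.{u}} (f : X ⟶ Y) :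
    M.spanFunctor.map (Sp.res f) = M.res f := by
  change M.res f ≫ M.tr (𝟙 X) = _
  rw [M.tr_id, Category.comp_id]

@[simp] theorem spanFunctor_map_tr {X Y : GrSet.{u}} (f : X ⟶ Y) :
    M.spanFunctor.map (Sp.tr f) = M.tr f := by
  change M.res (𝟙 X) ≫ M.tr f = _
  rw [M.res_id, Category.id_comp]

instance : PreservesFiniteProducts M.spanFunctor :=
  Sp.preservesFiniteProducts _ (M.additive_empty _ inferInstance) fun A B => by
    rw [spanFunctor_map_res, spanFunctor_map_res]
    exact isIso_prod_lift_iff.mp (M.additive _ _ (coprod.isTwoCoproduct A B))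

variable {M N} in
/-- The natural transformation given by a morphism of semi-Mackey functors. -/
def spanFunctorMap (φ : M ⟶ N) : M.spanFunctor ⟶ N.spanFunctor where
  app A := φ.app A.as
  naturality A B f := by
    obtain ⟨S, rfl⟩ := Sp.exists_ofSpan f
    change (M.res S.r ≫ M.tr S.l) ≫ φ.app B.as = φ.app A.as ≫ N.res S.r ≫ N.tr S.l
    rw [Category.assoc, φ.tr_app, ← Category.assoc, φ.res_app, Category.assoc]

variable {M N} in
/-- The morphism of semi-Mackey functors given by a natural transformation. -/
def ofNatTrans (τ : M.spanFunctor ⟶ N.spanFunctor) : M ⟶ N :=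
  Hom.mk (fun A => τ.app ⟨A⟩)
    (fun f => by
      rw [← spanFunctor_map_res, ← spanFunctor_map_res]
      exact τ.naturality _)
    (fun f => by
      rw [← spanFunctor_map_tr, ← spanFunctor_map_tr]
      exact τ.naturality _)

variable (D) in
/-- The functor from semi-Mackey functors to functors on the span category. -/
def toAddFun : SemiMackey.{u} D ⥤ AddFun Sp.{u} D where
  obj M := ⟨M.spanFunctor, inferInstanceAs (PreservesFiniteProducts M.spanFunctor)⟩
  map φ := ObjectProperty.homMk (spanFunctorMap φ)

/-- The semi-Mackey functor given by a functor on the span category. -/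
def ofFunctor (F : Sp.{u} ⥤ D) [PreservesFiniteProducts F] : SemiMackey.{u} D where
  obj A := F.obj ⟨A⟩
  res f := F.map (Sp.res f)
  tr f := F.map (Sp.tr f)
  res_id A := by rw [Sp.res_id, F.map_id]
  res_comp f g := by rw [Sp.res_comp, F.map_comp]
  res_cell η := by rw [Sp.res_cell η]
  tr_id A := by rw [Sp.tr_id, F.map_id]
  tr_comp f g := by rw [Sp.tr_comp, F.map_comp]
  tr_cell η := by rw [Sp.tr_cell η]
  additive i j h := isIso_prod_lift_iff.mpr ((Sp.isBiprod h).isProd.map F)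
  additive_empty A h := ⟨(Sp.nonempty_isTerminal h).some.isTerminalObj F _⟩
  mackey γ δ α β κ h := by rw [← F.map_comp, Sp.mackey h, F.map_comp]

/-- A functor on the span category is determined by the semi-Mackey functor that it gives. -/
def spanFunctorOfFunctorIso (F : Sp.{u} ⥤ D) [PreservesFiniteProducts F] :
    (ofFunctor F).spanFunctor ≅ F :=
  NatIso.ofComponents (fun _ => Iso.refl _) fun {A B} f => by
    obtain ⟨S, rfl⟩ := Sp.exists_ofSpan f
    change (F.map (Sp.res S.r) ≫ F.map (Sp.tr S.l)) ≫ 𝟙 _ = 𝟙 _ ≫ F.map (Sp.ofSpan S)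
    rw [Category.comp_id, Category.id_comp, ← F.map_comp, Sp.res_comp_tr_span]

instance : (toAddFun.{u} D).Faithful where
  map_injective h := Hom.ext (funext fun A =>
    congrArg (fun t => NatTrans.app (InducedCategory.Hom.hom t) ⟨A⟩) h)

instance : (toAddFun.{u} D).Full where
  map_surjective τ := ⟨ofNatTrans τ.hom, rfl⟩

instance : (toAddFun.{u} D).EssSurj where
  mem_essImage F := by
    -- The values on restrictions and transfers form a semi-Mackey functor, and the factorization of
    -- spans recovers `F` from it.
    have : PreservesFiniteProducts F.obj := F.property
    exact ⟨ofFunctor F.obj, ⟨ObjectProperty.isoMk _ (spanFunctorOfFunctorIso F.obj)⟩⟩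

instance : (toAddFun.{u} D).IsEquivalence where

theorem isSpanCorrespondence_toAddFun :
    IsSpanCorrespondence (toAddFun.{u} D ⋙ ObjectProperty.ι _) :=
  ⟨fun _ _ => Iso.refl _, fun M A B S => by
    refine (Category.comp_id _).trans (Eq.trans ?_ (Category.id_comp _).symm)
    rfl,
    fun φ A => (Category.comp_id _).trans (Category.id_comp _).symm⟩

end SemiMackey

/-! ### The commutative monoid of generalized elements. -/

namespace Sp

variable {D : Type d} [Category.{v} D] (F : Sp.{u} ⥤ D)

/-- The generalized elements of a value of a functor on the span category. -/
def Pt (X : D) (A : Sp.{u}) : Type v := X ⟶ F.obj A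

namespace Pt

variable {F} {X Y : D} {A B : Sp.{u}}

/-- The underlying morphism. -/
def hom (x : Pt F X A) : X ⟶ F.obj A := x

/-- The image of a generalized element under a morphism of the span category. -/
def map (x : Pt F X A) (s : A ⟶ B) : Pt F X B := x.hom ≫ F.map s

/-- The restriction of a generalized element. -/
def pre (f : Y ⟶ X) (x : Pt F X A) : Pt F Y A := f ≫ x.hom

theorem map_comp {C : Sp.{u}} (x : Pt F X A) (s : A ⟶ B) (t : B ⟶ C) :
    x.map (s ≫ t) = (x.map s).map t :=
  (congrArg (x.hom ≫ ·) (F.map_comp s t)).trans (Category.assoc _ _ _).symm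

theorem map_id (x : Pt F X A) : x.map (𝟙 A) = x :=
  (congrArg (x.hom ≫ ·) (F.map_id A)).trans (Category.comp_id _)

theorem pre_map (f : Y ⟶ X) (x : Pt F X A) (s : A ⟶ B) : (pre f x).map s = pre f (x.map s) :=
  Category.assoc _ _ _

/-- The image of a generalized element under a natural transformation. -/
def app {F' : Sp.{u} ⥤ D} (τ : F ⟶ F') (x : Pt F X A) : Pt F' X A :=
  x.hom ≫ τ.app A

theorem app_map {F' : Sp.{u} ⥤ D} (τ : F ⟶ F') (x : Pt F X A) (s : A ⟶ B) :
    app τ (x.map s) = (app τ x).map s :=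
  (Category.assoc _ _ _).trans ((congrArg (x.hom ≫ ·)
    (τ.naturality s)).trans (Category.assoc _ _ _).symm)

theorem app_inv_hom {F' : Sp.{u} ⥤ D} (e : F ≅ F') (x : Pt F' X A) :
    app e.hom (app e.inv x) = x :=
  (Category.assoc _ _ _).trans ((congrArg (x.hom ≫ ·)
    (e.inv_hom_id_app A)).trans (Category.comp_id _))

theorem isBiprod_double (A : GrSet.{u}) : IsBiprod (double.inl A) (double.inr A) :=
  isBiprod (double.isTwoCoproduct A)

theorem inl_fold (A : GrSet.{u}) : tr (double.inl A) ≫ tr (double.fold A) = 𝟙 _ :=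
  (tr_comp _ _).symm

theorem inr_fold (A : GrSet.{u}) : tr (double.inr A) ≫ tr (double.fold A) = 𝟙 _ :=
  (tr_comp _ _).symm

variable [PreservesFiniteProducts F]

theorem existsUnique_map {A B P : GrSet.{u}} {i : A ⟶ P} {j : B ⟶ P} (h : IsBiprod i j)
    (x : Pt F X ⟨A⟩) (y : Pt F X ⟨B⟩) :
    ∃! p : Pt F X ⟨P⟩, p.map (res i) = x ∧ p.map (res j) = y :=
  h.isProd.map F x y

noncomputable instance : Add (Pt F X A) :=
  ⟨fun x y => (existsUnique_map (isBiprod_double A.as) x y).choose.map (tr (double.fold A.as))⟩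

theorem map_fold (p : Pt F X ⟨double A.as⟩) :
    p.map (tr (double.fold A.as)) =
      (p.map (res (double.inl A.as)) + p.map (res (double.inr A.as)) : Pt F X A) := by
  have h := existsUnique_map (isBiprod_double A.as) (p.map (res (double.inl A.as)))
    (p.map (res (double.inr A.as)))
  exact congrArg (fun q : Pt F X ⟨double A.as⟩ => q.map (tr (double.fold A.as)))
    (h.unique ⟨rfl, rfl⟩ h.choose_spec.1)

/-- Spread `s` and `t` over the two summands of the doubled object. The resulting element restricts
to the images under `s` and `t`, while folding it gives the image under `s + t`. -/
theorem map_add (x : Pt F X A) (s t : A ⟶ B) : x.map (s + t) = x.map s + x.map t := by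
  have b := isBiprod_double B.as
  have h := map_fold (A := B) (x.map (s ≫ tr (double.inl B.as) + t ≫ tr (double.inr B.as)))
  rw [← map_comp, ← map_comp, ← map_comp, add_comp, add_comp, add_comp] at h
  simp only [Category.assoc, inl_fold, inr_fold, b.inl_fst, b.inl_snd, b.inr_fst, b.inr_snd,
    comp_zero, zero_add, add_zero] at h
  simpa only [Category.comp_id] using h

/-- The zero element, through the value at the empty 0-cell. -/
noncomputable instance : Zero (Pt F X A) :=
  ⟨map (F := F) (A := ⟨empty⟩)
    (((nonempty_isTerminal (A := empty) inferInstance).some.isTerminalObj F _).from X) 0⟩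

theorem subsingleton_empty (x y : Pt F X ⟨empty⟩) : x = y :=
  ((nonempty_isTerminal (A := empty) inferInstance).some.isTerminalObj F _).hom_ext x y

/-- A zero morphism factors through the empty 0-cell, whose value is terminal. -/
theorem map_zero (x : Pt F X A) : x.map (0 : A ⟶ B) = 0 := by
  have h : (0 : A ⟶ B) = (0 : A ⟶ ⟨empty⟩) ≫ 0 := (comp_zero _).symm
  rw [h, map_comp]
  exact congrArg (fun y : Pt F X ⟨empty⟩ => y.map (0 : _ ⟶ B)) (subsingleton_empty _ _)

/-- Both elements are images of a single element of the value at the doubled object. This reduces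
identities between sums of elements, by `map_add`, to identities in the morphism monoids of `Sp`. -/
theorem exists_map_eq (x y : Pt F X A) :
    ∃ (P : Sp.{u}) (p : Pt F X P) (s t : P ⟶ A), p.map s = x ∧ p.map t = y := by
  obtain ⟨p, hp, -⟩ := existsUnique_map (isBiprod_double A.as) x y
  exact ⟨_, p, _, _, hp⟩

theorem exists_map_eq₃ (x y z : Pt F X A) :
    ∃ (P : Sp.{u}) (p : Pt F X P) (s t r : P ⟶ A), p.map s = x ∧ p.map t = y ∧ p.map r = z := by
  obtain ⟨P, p, s, t, rfl, rfl⟩ := exists_map_eq x y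
  obtain ⟨q, ⟨rfl, rfl⟩, -⟩ := existsUnique_map (isBiprod_coprod P.as A.as) p z
  exact ⟨_, q, res (coprod.inl P.as A.as) ≫ s, res (coprod.inl P.as A.as) ≫ t, _,
    map_comp _ _ _, map_comp _ _ _, rfl⟩

noncomputable instance : AddCommMonoid (Pt F X A) where
  add_assoc x y z := by
    obtain ⟨P, p, s, t, r, rfl, rfl, rfl⟩ := exists_map_eq₃ x y z
    simp only [← map_add, add_assoc]
  zero_add x := by
    conv_lhs => rw [← map_id x, ← map_zero (A := A) (B := A) x, ← map_add, zero_add, map_id]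
  add_zero x := by
    conv_lhs => rw [← map_id x, ← map_zero (A := A) (B := A) x, ← map_add, add_zero, map_id]
  add_comm x y := by
    obtain ⟨P, p, s, t, rfl, rfl⟩ := exists_map_eq x y
    simp only [← map_add, add_comm]
  nsmul := nsmulRec

/-- A morphism of the span category acts additively. -/
theorem add_map (x y : Pt F X A) (s : A ⟶ B) : (x + y).map s = x.map s + y.map s := by
  obtain ⟨P, p, t, t', rfl, rfl⟩ := exists_map_eq x y
  simp only [← map_add, ← map_comp, add_comp]

theorem pre_add (f : Y ⟶ X) (x y : Pt F X A) : pre f (x + y) = pre f x + pre f y := by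
  obtain ⟨P, p, s, t, rfl, rfl⟩ := exists_map_eq x y
  simp only [← map_add, ← pre_map]

variable {F' : Sp.{u} ⥤ D} [PreservesFiniteProducts F'] (τ : F ⟶ F')

/-- Natural transformations are additive. -/
theorem app_add (x y : Pt F X A) : app τ (x + y) = app τ x + app τ y := by
  obtain ⟨P, p, s, t, rfl, rfl⟩ := exists_map_eq x y
  simp only [← map_add, app_map]

theorem app_zero : app τ (0 : Pt F X A) = 0 := by
  obtain ⟨P, p, s, t, -, -⟩ := exists_map_eq (0 : Pt F X A) 0
  rw [← map_zero p, app_map, map_zero]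

variable (F A B) in
/-- The action of a functor on morphisms, as a homomorphism. -/
noncomputable def mapHom : (A ⟶ B) →+ Pt F (F.obj A) B where
  toFun s := F.map s
  map_zero' := by
    exact (Category.id_comp (F.map 0)).symm.trans
      (map_zero (B := B) (𝟙 (F.obj A) : Pt F (F.obj A) A))
  map_add' s t := by
    -- Additivity on morphisms is additivity at the universal element, the identity.
    have h := map_add (𝟙 (F.obj A) : Pt F (F.obj A) A) s t
    simpa only [map, hom, Category.id_comp] using h

end Pt

/-- A product preserving functor on the span category is grouplike if its values are group
objects. -/
class IsGrouplike (F : Sp.{u} ⥤ D) [PreservesFiniteProducts F] : Prop where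
  exists_add_eq_zero : ∀ {X : D} {A : Sp.{u}} (x : Pt F X A), ∃ y, x + y = 0

theorem IsGrouplike.of_iso {F F' : Sp.{u} ⥤ D} [PreservesFiniteProducts F]
    [PreservesFiniteProducts F'] (e : F ≅ F') [IsGrouplike F] : IsGrouplike F' where
  exists_add_eq_zero {X A} x := by
    obtain ⟨y, hy⟩ := IsGrouplike.exists_add_eq_zero (Pt.app e.inv x)
    refine ⟨Pt.app e.hom y, ?_⟩
    have h := congrArg (Pt.app e.hom) hy
    rwa [Pt.app_add, Pt.app_zero, Pt.app_inv_hom] at h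

end Sp

instance {C : Type c} [Category.{v2} C] {D : Type d} [Category.{v} D] (F : AddFun C D) :
    PreservesFiniteProducts F.obj :=
  F.property

/-! ### Extending grouplike functors from `Sp` to `𝒯`. -/

section Extension

variable {D : Type d} [Category.{v} D]

namespace Sp

variable {F : Sp.{u} ⥤ D} [PreservesFiniteProducts F]

namespace Pt

variable {X Y : D} {A B : Sp.{u}}

noncomputable instance [IsGrouplike F] : Neg (Pt F X A) :=
  ⟨fun x => (IsGrouplike.exists_add_eq_zero x).choose⟩

/-- The generalized elements of a grouplike functor form groups. -/
noncomputable instance [IsGrouplike F] : AddCommGroup (Pt F X A) where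
  neg_add_cancel x := (add_comm _ _).trans (IsGrouplike.exists_add_eq_zero x).choose_spec
  add_comm := add_comm
  zsmul := zsmulRec

/-- The restriction of generalized elements, as a homomorphism. -/
noncomputable def preHom (f : Y ⟶ X) : Pt F X A →+ Pt F Y A where
  toFun := pre f
  map_zero' := by
    rw [← map_zero (0 : Pt F X A) (B := A), ← pre_map, map_zero]
  map_add' := pre_add f

/-- The action of a morphism of the span category, as a homomorphism. -/
noncomputable def actHom (s : A ⟶ B) : Pt F X A →+ Pt F X B :=
  { toFun := fun x => x.map s
    map_zero' := by rw [← map_zero (0 : Pt F X A) (B := A), ← map_comp, zero_comp, map_zero]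
    map_add' := fun x y => add_map x y s }

end Pt

end Sp

namespace Tcal

open Sp (Pt IsGrouplike)

section Extend

variable (F : Sp.{u} ⥤ D) [PreservesFiniteProducts F] [IsGrouplike F]

/-- The extension of a grouplike functor to the morphisms of `𝒯`. -/
noncomputable def extendHom (A B : GrSet.{u}) : Hom ⟨A⟩ ⟨B⟩ →+ Pt F (F.obj ⟨A⟩) ⟨B⟩ :=
  lift (Pt.mapHom F ⟨A⟩ ⟨B⟩)

theorem extendHom_of {A B : GrSet.{u}} (s : (⟨A⟩ : Sp.{u}) ⟶ ⟨B⟩) :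
    extendHom F A B (of s) = Pt.mapHom F _ _ s :=
  lift_of _ _

/-- The extension of a grouplike functor to `𝒯`. -/
noncomputable def extend : Tcal.{u} ⥤ D where
  obj A := F.obj ⟨A.as⟩
  map {A B} x := (extendHom F A.as B.as x).hom
  map_id A := (congrArg Pt.hom (extendHom_of F (𝟙 _))).trans (F.map_id _)
  map_comp {A B C} x y := by
    obtain ⟨s, t, rfl⟩ := exists_eq_sub x
    obtain ⟨s', t', rfl⟩ := exists_eq_sub y
    -- Both sides are written as values of homomorphisms, so that they expand over the two
    -- differences and functoriality reduces to that of `F` on spans.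
    change (extendHom F A.as C.as (compHom _ _ _ (of s - of t) (of s' - of t'))).hom =
      (Pt.preHom (extendHom F A.as B.as (of s - of t)).hom
        (extendHom F B.as C.as (of s' - of t'))).hom
    -- The composite `f ≫ F.map r` is additive in `r` as a restriction along `f`, and additive in
    -- `f` as the action of `r`; changing the reading exposes the second variable.
    have key (f : Pt F (F.obj ⟨A.as⟩) ⟨B.as⟩) (r : (⟨B.as⟩ : Sp.{u}) ⟶ ⟨C.as⟩) :
        Pt.preHom f.hom (Pt.mapHom F _ _ r) = Pt.actHom r f := rfl
    have key' (p : (⟨A.as⟩ : Sp.{u}) ⟶ ⟨B.as⟩) (r : (⟨B.as⟩ : Sp.{u}) ⟶ ⟨C.as⟩) :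
        Pt.actHom r (Pt.mapHom F _ _ p) = Pt.mapHom F _ _ (p ≫ r) := (F.map_comp p r).symm
    simp only [map_sub, AddMonoidHom.sub_apply, compHom_of, extendHom_of, key, key']

/-- An equality of functors, not merely an isomorphism; the commutation of the two equivalences in
the main theorem is strict and relies on it. -/
theorem c_comp_extend : c ⋙ extend F = F :=
  Functor.hext (fun _ => rfl) fun _ _ s => heq_of_eq (extendHom_of F s)

/-- The extension of a functor restricts to the functor. -/
noncomputable def extendIso : c ⋙ extend F ≅ F :=
  NatIso.ofComponents (fun _ => Iso.refl _) fun s =>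
    (Category.comp_id _).trans ((extendHom_of F s).trans (Category.id_comp _).symm)

instance : PreservesFiniteProducts (extend F) :=
  have : PreservesFiniteProducts (c ⋙ extend F) := by rwa [c_comp_extend]
  preservesFiniteProducts _

end Extend

/-! ### Restricting functors from `𝒯` to `Sp`. -/

section Restrict

variable (G : Tcal.{u} ⥤ D) {X : D} {A B : Sp.{u}}

/-- The action of a morphism of `𝒯` on generalized elements. -/
noncomputable def act (x : Pt (c ⋙ G) X A) (s : c.obj A ⟶ c.obj B) : Pt (c ⋙ G) X B := x.hom ≫ G.map s

variable {G}

theorem act_c_map (x : Pt (c ⋙ G) X A) (s : A ⟶ B) : act G x (c.map s) = x.map s := rfl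

theorem act_comp {C : Sp.{u}} (x : Pt (c ⋙ G) X A) (s : c.obj A ⟶ c.obj B)
    (t : c.obj B ⟶ c.obj C) : act G x (s ≫ t) = act G (act G x s) t :=
  (congrArg (x.hom ≫ ·) (G.map_comp s t)).trans (Category.assoc _ _ _).symm

theorem act_id (x : Pt (c ⋙ G) X A) : act G x (𝟙 _) = x :=
  (congrArg (x.hom ≫ ·) (G.map_id _)).trans (Category.comp_id _)

variable [PreservesFiniteProducts G]

/-- The folding argument of `Sp.Pt.map_add`, now with coefficients in `𝒯`, where the biproduct
equations hold as images under `c`. -/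
theorem act_add (x : Pt (c ⋙ G) X A) (s t : c.obj A ⟶ c.obj B) :
    act G x (s + t) = act G x s + act G x t := by
  have b := Sp.Pt.isBiprod_double B.as
  have h := Sp.Pt.map_fold (A := B)
    (act G x (s ≫ c.map (Sp.tr (double.inl B.as)) + t ≫ c.map (Sp.tr (double.inr B.as))))
  have e {P Q R : Sp.{u}} {f : P ⟶ Q} {g : Q ⟶ R} {k : P ⟶ R} (h : f ≫ g = k) :
    c.map f ≫ c.map g = c.map k := by rw [← h, c.map_comp]
  simp only [← act_c_map, ← act_comp, Preadditive.add_comp, Category.assoc, e b.inl_fst,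
    e b.inl_snd, e b.inr_fst, e b.inr_snd, e (Sp.Pt.inl_fold B.as), e (Sp.Pt.inr_fold B.as),
    c_map_zero, comp_zero, add_zero, zero_add, c.map_id, Category.comp_id] at h
  exact h

/-- The negative of the identity in `𝒯` acts as an additive inverse: its sum with the identity is
zero, and zero acts by zero. -/
instance : IsGrouplike (c ⋙ G) where
  exists_add_eq_zero x := ⟨act G x (-𝟙 _), by
    conv_lhs => rw [← act_id x]
    rw [act_id, ← act_id x, ← act_comp, Category.id_comp, ← act_add, add_neg_cancel,
      ← c_map_zero, act_c_map, Sp.Pt.map_zero]⟩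

/-- A natural transformation between the restrictions to the span category is natural on `𝒯`. -/
@[simps] noncomputable def liftNatTrans {G' : Tcal.{u} ⥤ D} [PreservesFiniteProducts G']
    (τ : c ⋙ G ⟶ c ⋙ G') : G ⟶ G' where
  app A := τ.app ⟨A.as⟩
  naturality A B x := by
    obtain ⟨s, t, rfl⟩ := exists_eq_c_map_sub (A := ⟨A.as⟩) (B := ⟨B.as⟩) x
    let e : Pt (c ⋙ G) (G.obj A) ⟨A.as⟩ := 𝟙 (G.obj A)
    -- Moving the subtrahend across leaves only naturality at `s` and at `t`; the common term is
    -- then cancelled in the group of elements of `c ⋙ G'`.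
    have h₁ : act G e (c.map s - c.map t) + act G e (c.map t) = act G e (c.map s) := by
      rw [← act_add, sub_add_cancel]
    have h₂ : act G' (Pt.app τ e) (c.map s - c.map t) + act G' (Pt.app τ e) (c.map t) =
        act G' (Pt.app τ e) (c.map s) := by
      rw [← act_add, sub_add_cancel]
    have h₃ := congrArg (Pt.app τ) h₁
    rw [Pt.app_add, act_c_map, act_c_map, Pt.app_map, Pt.app_map, ← act_c_map, ← act_c_map, ← h₂]
      at h₃
    have h₄ := add_right_cancel h₃
    change (𝟙 _ ≫ G.map _) ≫ τ.app _ = (𝟙 _ ≫ τ.app ⟨A.as⟩) ≫ G'.map _ at h₄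
    rwa [Category.id_comp, Category.id_comp] at h₄

/-- Functors on `𝒯` are isomorphic if their restrictions to the span category are. -/
noncomputable def liftNatIso {G' : Tcal.{u} ⥤ D} [PreservesFiniteProducts G']
    (e : c ⋙ G ≅ c ⋙ G') : G ≅ G' where
  hom := liftNatTrans e.hom
  inv := liftNatTrans e.inv
  hom_inv_id := by ext A; exact e.hom_inv_id_app ⟨A.as⟩
  inv_hom_id := by ext A; exact e.inv_hom_id_app ⟨A.as⟩

end Restrict

/-! ### The equivalence between grouplike functors on `Sp` and functors on `𝒯`. -/

section Equivalence

variable {F F' : Sp.{u} ⥤ D} [PreservesFiniteProducts F] [IsGrouplike F]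
  [PreservesFiniteProducts F'] [IsGrouplike F']

/-- The extension of a natural transformation to `𝒯`. -/
noncomputable def extendMap (τ : F ⟶ F') : extend F ⟶ extend F' where
  app A := τ.app ⟨A.as⟩
  naturality A B x := by
    have h := (liftNatTrans ((extendIso F).hom ≫ τ ≫ (extendIso F').inv)).naturality x
    have e (P : Sp.{u}) : ((extendIso F).hom ≫ τ ≫ (extendIso F').inv).app P = τ.app P :=
      (Category.id_comp _).trans (Category.comp_id _)
    rwa [liftNatTrans_app, liftNatTrans_app, e, e] at h

theorem extendMap_surjective (σ : extend F ⟶ extend F') : ∃ τ : F ⟶ F', extendMap τ = σ := by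
  refine ⟨(extendIso F).inv ≫ Functor.whiskerLeft c σ ≫ (extendIso F').hom, ?_⟩
  ext A
  exact (Category.id_comp _).trans (Category.comp_id _)

variable {E : Type c} [Category.{v2} E] (K : E ⥤ AddFun Sp.{u} D)
  [hK : ∀ M, IsGrouplike (K.obj M).obj]

/-- The functor to functors on `𝒯` given by a functor to grouplike functors on `Sp`. -/
noncomputable def extendFunctor : E ⥤ AddFun Tcal.{u} D where
  obj M := ⟨extend (K.obj M).obj, inferInstanceAs (PreservesFiniteProducts (extend _))⟩
  map φ := ObjectProperty.homMk (extendMap (K.map φ).hom)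
  map_id M := by
    ext A
    exact congrArg (fun t => NatTrans.app (InducedCategory.Hom.hom t) ⟨A.as⟩) (K.map_id M)
  map_comp φ ψ := by
    ext A
    exact congrArg (fun t => NatTrans.app (InducedCategory.Hom.hom t) ⟨A.as⟩) (K.map_comp φ ψ)

theorem extendFunctor_comp :
    (extendFunctor K ⋙ ObjectProperty.ι _) ⋙ precompC.{u} D = K ⋙ ObjectProperty.ι _ := by
  refine CategoryTheory.Functor.ext (fun M => c_comp_extend (K.obj M).obj) fun M N φ => ?_
  ext A
  refine Eq.trans ?_ (congrArg₂ (fun a b => a ≫ (K.map φ).hom.app A ≫ b)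
    (eqToHom_app (c_comp_extend (K.obj M).obj) A).symm
    (eqToHom_app (c_comp_extend (K.obj N).obj).symm A).symm)
  exact ((Category.id_comp _).trans (Category.comp_id _)).symm

instance [K.Faithful] : (extendFunctor K).Faithful where
  map_injective h := K.map_injective (by
    ext A
    exact congrArg (fun t => NatTrans.app (InducedCategory.Hom.hom t) ⟨A.as⟩) h)

instance [K.Full] : (extendFunctor K).Full where
  map_surjective σ := by
    obtain ⟨τ, hτ⟩ := extendMap_surjective σ.hom
    obtain ⟨φ, hφ⟩ := K.map_surjective (ObjectProperty.homMk τ)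
    refine ⟨φ, ?_⟩
    ext A
    rw [← hτ]
    exact congrArg (fun t => NatTrans.app (InducedCategory.Hom.hom t) ⟨A.as⟩) hφ

/-- Full faithfulness passes from `K` to its extension. A functor on `𝒯` restricts to a grouplike
functor, which `K` reaches by hypothesis, and an isomorphism of restrictions lifts to `𝒯`. -/
theorem extendFunctor_isEquivalence [K.Full] [K.Faithful]
    (h : ∀ F : AddFun Sp.{u} D, IsGrouplike F.obj → K.essImage F) :
    (extendFunctor K).IsEquivalence where
  essSurj := ⟨fun G => by
    obtain ⟨M, ⟨e⟩⟩ := h ⟨c ⋙ G.obj, inferInstanceAs (PreservesFiniteProducts (c ⋙ G.obj))⟩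
      (inferInstanceAs (IsGrouplike (c ⋙ G.obj)))
    exact ⟨M, ⟨ObjectProperty.isoMk _ (liftNatIso (G := extend (K.obj M).obj)
      (extendIso (K.obj M).obj ≪≫ (ObjectProperty.ι _).mapIso e))⟩⟩⟩

end Equivalence

end Tcal

end Extension

open Sp (Pt IsGrouplike)

/-! ### Preadditive targets. -/

namespace Sp

section Preadditive

variable {D : Type d} [Category.{v} D] [Preadditive D] (F : Sp.{u} ⥤ D) [PreservesFiniteProducts F]

theorem map_zero_of_preadditive (A B : Sp.{u}) : F.map (0 : A ⟶ B) = 0 := by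
  have h : (0 : A ⟶ B) = (0 : A ⟶ ⟨empty⟩) ≫ 0 := (comp_zero _).symm
  rw [h, F.map_comp, ((nonempty_isTerminal (A := empty) inferInstance).some.isTerminalObj F
    _).hom_ext (F.map 0) 0, Limits.zero_comp]

/-- The addition defined by folding must agree with that of the target, which already has negatives.
-/
theorem Pt.add_eq_of_preadditive {X : D} {A : Sp.{u}} (x y : Pt F X A) :
    x + y = (x.hom + y.hom : X ⟶ F.obj A) := by
  have b := Pt.isBiprod_double A.as
  have e {P Q R : Sp.{u}} {f : P ⟶ Q} {g : Q ⟶ R} {k : P ⟶ R} (h : f ≫ g = k) :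
    F.map f ≫ F.map g = F.map k := by rw [← h, F.map_comp]
  -- The element of the doubled object with restrictions `x` and `y`, built with the addition of
  -- `D`; folding it gives their sum in `D`.
  let p : Pt F X ⟨double A.as⟩ :=
    (x.hom ≫ F.map (tr (double.inl A.as)) + y.hom ≫ F.map (tr (double.inr A.as)) :
      X ⟶ F.obj ⟨double A.as⟩)
  have h := Pt.map_fold (A := A) p
  have h₁ : p.map (res (double.inl A.as)) = x := by
    change (_ + _) ≫ _ = x.hom
    rw [Preadditive.add_comp, Category.assoc, Category.assoc, e b.inl_fst, e b.inr_fst,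
      map_zero_of_preadditive, Limits.comp_zero, add_zero, F.map_id, Category.comp_id]
  have h₂ : p.map (res (double.inr A.as)) = y := by
    change (_ + _) ≫ _ = y.hom
    rw [Preadditive.add_comp, Category.assoc, Category.assoc, e b.inl_snd, e b.inr_snd,
      map_zero_of_preadditive, Limits.comp_zero, zero_add, F.map_id, Category.comp_id]
  rw [h₁, h₂] at h
  rw [← h]
  change (_ + _) ≫ _ = _
  rw [Preadditive.add_comp, Category.assoc, Category.assoc, e (Pt.inl_fold A.as),
    e (Pt.inr_fold A.as), F.map_id, Category.comp_id, Category.comp_id]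

instance isGrouplike_of_preadditive : IsGrouplike F where
  exists_add_eq_zero {X A} x := by
    let y : Pt F X A := (-x.hom : X ⟶ F.obj A)
    refine ⟨y, (Pt.add_eq_of_preadditive F x y).trans ((add_neg_cancel x.hom).trans ?_)⟩
    rw [← Pt.map_zero (B := A) x]
    exact ((congrArg (x.hom ≫ ·) (map_zero_of_preadditive F A A)).trans Limits.comp_zero).symm

end Preadditive

end Sp

/-! ### Mackey functors are the grouplike semi-Mackey functors. -/

namespace SemiMackey

variable (M : SemiMackey.{u} (Type w))

theorem add_res (A : GrSet.{u}) (p : M.obj (double A)) :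
    M.add (M.res (double.inl A) p) (M.res (double.inr A) p) = M.tr (double.fold A) p :=
  congrArg (M.tr (double.fold A))
    ((Equiv.ofBijective _ (M.bijective_res _ _ (double.isTwoCoproduct A))).symm_apply_apply p)

theorem eq_of_empty (x y : M.obj empty) : x = y :=
  ((Types.isTerminalEquivUnique _ (M.additive_empty empty inferInstance).some).uniq x).trans
    ((Types.isTerminalEquivUnique _ (M.additive_empty empty inferInstance).some).uniq y).symm

/-- For sets, both additions fold the unique element with the prescribed restrictions, so
generalized elements add pointwise. -/
theorem add_apply {X : Type w} {A : GrSet.{u}} (f g : Pt M.spanFunctor X ⟨A⟩) (x : X) :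
    (f + g).hom x = M.add (f.hom x) (g.hom x) := by
  obtain ⟨p, ⟨rfl, rfl⟩, -⟩ := Pt.existsUnique_map (Pt.isBiprod_double A) f g
  rw [← Pt.map_fold (A := ⟨A⟩)]
  simp only [Pt.map, Pt.hom, spanFunctor_map_res, spanFunctor_map_tr]
  exact (M.add_res A _).symm

theorem zero_apply {X : Type w} {A : GrSet.{u}} (x : X) :
    (0 : Pt M.spanFunctor X ⟨A⟩).hom x = M.zero A := by
  have h : (0 : (⟨empty⟩ : Sp.{u}) ⟶ ⟨A⟩) = Sp.tr (fromEmpty A) := by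
    rw [← Category.id_comp (Sp.tr _), Sp.id_eq_zero inferInstance, Sp.zero_comp]
  obtain ⟨p⟩ : Nonempty (Pt M.spanFunctor X ⟨empty⟩) := ⟨0⟩
  rw [← Pt.map_zero p, h]
  simp only [Pt.map, Pt.hom, spanFunctor_map_tr]
  exact congrArg (M.tr (fromEmpty A)) (M.eq_of_empty _ _)

/-- Inverses chosen pointwise assemble into a map of sets, which gives one direction; for the other,
elements of `M(X/G)` are generalized elements over a point. -/
theorem isMackey_iff_isGrouplike : IsMackey M ↔ IsGrouplike M.spanFunctor := by
  refine ⟨fun h => ⟨fun {X A} f => ?_⟩, fun h A m => ?_⟩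
  · choose g hg using h A.as
    refine ⟨(↾fun x => g (f.hom x) : X ⟶ M.obj A.as), ?_⟩
    refine ConcreteCategory.hom_ext (C := Type w) (X := X) (Y := M.obj A.as) _ _ fun x => ?_
    exact (M.add_apply _ _ x).trans ((hg (f.hom x)).1.trans (M.zero_apply x).symm)
  · let f : Pt M.spanFunctor PUnit ⟨A⟩ := (↾fun _ => m : PUnit ⟶ M.obj A)
    obtain ⟨g, hg⟩ := IsGrouplike.exists_add_eq_zero f
    have hg' := (add_comm g f).trans hg
    refine ⟨g.hom PUnit.unit, ?_, ?_⟩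
    · exact (M.add_apply f g _).symm.trans ((congrArg (fun k : Pt M.spanFunctor PUnit ⟨A⟩ => k.hom PUnit.unit) hg).trans
        (M.zero_apply _))
    · exact (M.add_apply g f _).symm.trans ((congrArg (fun k : Pt M.spanFunctor PUnit ⟨A⟩ => k.hom PUnit.unit) hg').trans
        (M.zero_apply _))

instance (M : Mack.{u, w}) :
    IsGrouplike ((ObjectProperty.ι _ ⋙ toAddFun.{u} (Type w)).obj M).obj :=
  (isMackey_iff_isGrouplike M.obj).mp M.property

theorem mem_essImage_mack (F : AddFun Sp.{u} (Type w)) (hF : IsGrouplike F.obj) :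
    (IsMackey.{u, w}.ι ⋙ toAddFun.{u} (Type w)).essImage F :=
  ⟨⟨ofFunctor F.obj, (isMackey_iff_isGrouplike _).mpr
    (IsGrouplike.of_iso (spanFunctorOfFunctorIso F.obj).symm)⟩,
    ⟨ObjectProperty.isoMk _ (spanFunctorOfFunctorIso F.obj)⟩⟩

instance {D : Type d} [Category.{v} D] [Preadditive D] [HasFiniteProducts D]
    (M : SemiMackey.{u} D) : IsGrouplike ((toAddFun.{u} D).obj M).obj :=
  Sp.isGrouplike_of_preadditive _

end SemiMackey

end BisetMackey

theorem proposition4 (R : Type r) [CommRing R] :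
    (∃ (Φ : CategoryTheory.Equivalence BisetMackey.SMack.{u, w}
          (BisetMackey.AddFun BisetMackey.Sp.{u} (Type w)))
        (Ψ : CategoryTheory.Equivalence BisetMackey.Mack.{u, w}
          (BisetMackey.AddFun BisetMackey.Tcal.{u} (Type w))),
      BisetMackey.IsSpanCorrespondence
        (Φ.functor.comp (CategoryTheory.ObjectProperty.ι _)) ∧
      (Ψ.functor.comp (CategoryTheory.ObjectProperty.ι _)).comp
          (BisetMackey.precompC.{u} (Type w)) =
        (CategoryTheory.ObjectProperty.ι _).comp
          (Φ.functor.comp (CategoryTheory.ObjectProperty.ι _))) ∧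
    ∃ Θ : CategoryTheory.Equivalence (BisetMackey.MackLin.{u, v} R)
        (BisetMackey.AddFun BisetMackey.Tcal.{u} (ModuleCat.{v} R)),
      BisetMackey.IsSpanCorrespondence
        ((Θ.functor.comp (CategoryTheory.ObjectProperty.ι _)).comp
          (BisetMackey.precompC.{u} (ModuleCat.{v} R))) := by
  have := BisetMackey.Tcal.extendFunctor_isEquivalence _ BisetMackey.SemiMackey.mem_essImage_mack
  have := BisetMackey.Tcal.extendFunctor_isEquivalence
    (BisetMackey.SemiMackey.toAddFun.{u} (ModuleCat.{v} R))
    (fun F _ => CategoryTheory.Functor.EssSurj.mem_essImage _ F)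
  refine ⟨⟨(BisetMackey.SemiMackey.toAddFun (Type w)).asEquivalence,
    (BisetMackey.Tcal.extendFunctor (CategoryTheory.Functor.comp (CategoryTheory.ObjectProperty.ι _)
      (BisetMackey.SemiMackey.toAddFun (Type w)))).asEquivalence,
    BisetMackey.SemiMackey.isSpanCorrespondence_toAddFun,
    BisetMackey.Tcal.extendFunctor_comp _⟩,
    (BisetMackey.Tcal.extendFunctor
      (BisetMackey.SemiMackey.toAddFun (ModuleCat.{v} R))).asEquivalence, ?_⟩
  -- Restricting the extended functor along `c` gives back `toAddFun` on the nose, so the linear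
  -- correspondence is the one already known on `Sp`.
  have h := BisetMackey.SemiMackey.isSpanCorrespondence_toAddFun.{u} (D := ModuleCat.{v} R)
  rwa [← BisetMackey.Tcal.extendFunctor_comp] at h
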